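/- **Setting.** Let $\Gamma$ be a group, $\Gamma'=\{\Gamma_i\}_{i\in I}$ a finite non-empty family of subgroups (repetitions allowed), and $S\not\ni 1$ a finite symmetric generating set of $\Gamma$ such that $S\cap\Gamma_i$ generates $\Gamma_i$ for every $i\in I$. The *combinatorial horoball* over a graph $G$ has vertex set $G^{(0)}\times\mathbb N$, an edge between $(g,m)$ and $(g,m+1)$ for all $g,m$, and an edge between $(g,m)$ and $(h,m)$ whenever $0<d_G(g,h)\le 2^m$. The *cusped graph* $X$ is obtained from the Cayley graph of $\Gamma$ ($g,h$ adjacent iff $g^{-1}h\in S$) by gluing, for every $i\in I$ and every coset $g\Gamma_i$, the horoball over $g\Gamma_i$ (with the Cayley graph structure given by $S\cap\Gamma_i$) along its vertices of height $0$. Its vertices are the triples $(g,i,m)\in\Gamma\times I\times\mathbb N$, where $(g,i,0)=(g,j,0)$ for all $i,j$; the *height* of $(g,i,m)$ is $m$. For $C\in\mathbb N$, the *$C$-horoball* associated with $g\Gamma_i$ has as vertices the $(h,i,m)$ with $h\in g\Gamma_i$, $m\ge C$. Suppose that $X$ is $\delta$-hyperbolic for some $\delta\in\mathbb N$ (geodesic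 triangles with vertices in $X^{(0)}$ are $\delta$-slim: each vertex on a side is at distance at most $\delta$ from a vertex of another side). Fix integers $\kappa\ge 4\delta+6$ and $C>\delta$. Let $\mathscr R=\mathscr R_\kappa(X)$ be the Rips complex, whose simplices are the non-empty finite sets of vertices of $X$ of diameter at most $\kappa$ in $X$. A $C$-horoball of $\mathscr R$ is the full subcomplex with the vertices of a $C$-horoball of $X$. For $A\subseteq \mathscr R^{(0)}$ and $r\in\mathbb N$, $\mathscr N_r(A)$ is the full subcomplex of $\mathscr R$ spanned by the vertices at distance at most $r$ from $A$ in the graph metric of the $1$-skeleton of $\mathscr R$. Let $C_*(\mathscr R)$ be the complex of simplicial (oriented) chains with real coefficients, $Z_k(\mathscr R)\subseteq C_k(\mathscr R)$ the cycles, $\operatorname{Supp} c$ the set of (unoriented) simplices with non-zero coefficient in $c$, $\|c\|$ the $\ell^1$-norm with respect to the simplices, and $\operatorname{maxh} c$ the largest height of a vertex of a simplex in $\operatorname{Supp} c$ ($0$ if $c=0$). **Theorem.** Let $n,k,L\in\mathbb N$ with $k\ge 2$. Then there exist $L'=L'(n,k,L)\in\mathbb N$ and a function $M=M(n,k,L):\mathbb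 N\to\mathbb N$ such that, for every cycle $z\in Z_k(\mathscr R)$ and every family of geodesic segments $\alpha_1,\dots,\alpha_n$ of $X$ (joining vertices, and identified with their sets of vertices) with $\operatorname{Supp} z\subseteq\mathscr N_L(\alpha_1\cup\dots\cup\alpha_n)$, there exists a single chain $a\in C_{k+1}(\mathscr R)$ such that 1. $\partial a=z$; 2. $\operatorname{Supp} a\subseteq\mathscr N_{L'}(\alpha_1\cup\dots\cup\alpha_n)$; 3. $\|a\|\le M(\operatorname{maxh} z)\,\|z\|$; 4. if $z$ is contained in some $C$-horoball of $\mathscr R$, then $a$ is contained in the same $C$-horoball. -/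

import Mathlib

noncomputable section

namespace CuspedRips

universe u v

/-! ### Geodesics and hyperbolicity of graphs -/

section Graph

variable {V : Type u}

/-- A geodesic segment of a graph, joining two vertices: an edge path whose length is the
graph distance of its endpoints. -/
structure GeodesicSegment (G : SimpleGraph V) where
  {start finish : V}
  walk : G.Walk start finish
  length_eq : (walk.length : ℕ∞) = G.edist start finish

/-- The set of vertices of a geodesic segment. -/
def GeodesicSegment.points {G : SimpleGraph V} (α : GeodesicSegment G) : Set V :=
  {x | x ∈ α.walk.support}

/-- A graph is `δ`-hyperbolic (`δ` an integer) if its geodesic triangles are `δ`-slim: every vertex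
on one side is at distance at most `δ` from a vertex of the union of the other two sides. For a
natural number `δ`, slimness with the constant `δ` of the triangles of the geometric realization
implies this condition with the same `δ`. Since the three sides may be permuted and reversed, it is
enough to require the condition for one side. -/
def IsHyperbolic (G : SimpleGraph V) (δ : ℕ) : Prop :=
  ∀ (x y z : V) (p : G.Walk x y) (q : G.Walk y z) (r : G.Walk x z),
    (p.length : ℕ∞) = G.edist x y → (q.length : ℕ∞) = G.edist y z →
    (r.length : ℕ∞) = G.edist x z →
    ∀ a ∈ p.support, ∃ b, (b ∈ q.support ∨ b ∈ r.support) ∧ G.edist a b ≤ δ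

/-- The combinatorial horoball over a graph `G`. For the horizontal edges at height `0` the condition
`0 < d_G(g, h) ≤ 2 ^ 0` says that `g` and `h` are adjacent in `G`. The horoball over a disconnected
graph is the disjoint union of the horoballs over its connected components. -/
def horoballGraph (G : SimpleGraph V) : SimpleGraph (V × ℕ) where
  Adj a b :=
    (a.1 = b.1 ∧ (a.2 + 1 = b.2 ∨ b.2 + 1 = a.2)) ∨
    (a.2 = b.2 ∧ a.1 ≠ b.1 ∧ G.edist a.1 b.1 ≤ 2 ^ a.2)
  symm := ⟨by
    rintro a b (⟨h, h'⟩ | ⟨h, h', h''⟩)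
    · exact Or.inl ⟨h.symm, h'.symm⟩
    · refine Or.inr ⟨h.symm, h'.symm, ?_⟩
      rw [SimpleGraph.edist_comm, ← h]
      exact h''⟩
  loopless := ⟨by
    rintro a (⟨_, h⟩ | ⟨_, h, _⟩)
    · omega
    · exact h rfl⟩

end Graph

/-! ### The cusped graph of a group-pair -/

section CuspedGraph

/-- The vertices of the cusped graph: `base g` is the vertex `(g, i, 0)`, which is the same for
all `i`, and `cusp g i n` is the vertex `(g, i, n + 1)`. -/
inductive CuspVertex (Γ : Type u) (I : Type v) : Type (max u v)
  | base (g : Γ) : CuspVertex Γ I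
  | cusp (g : Γ) (i : I) (n : ℕ) : CuspVertex Γ I

variable {Γ : Type u} {I : Type v}

/-- The vertex `(g, i, n)` of the cusped graph. -/
def CuspVertex.mk (g : Γ) (i : I) : ℕ → CuspVertex Γ I
  | 0 => .base g
  | n + 1 => .cusp g i n

/-- The height of a vertex: `height (g, i, n) = n`. -/
def CuspVertex.height : CuspVertex Γ I → ℕ
  | .base _ => 0
  | .cusp _ _ n => n + 1

variable [Group Γ]

/-- `S` is a finite symmetric generating set of `Γ`, not containing `1`, which is compatible with
the family `P` of subgroups: `S ∩ P i` generates `P i` for every `i`. -/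
structure IsCompatible (P : I → Subgroup Γ) (S : Set Γ) : Prop where
  finite : S.Finite
  symmetric : ∀ s ∈ S, s⁻¹ ∈ S
  one_notMem : (1 : Γ) ∉ S
  closure_eq : Subgroup.closure S = ⊤
  closure_inter_eq : ∀ i, Subgroup.closure (S ∩ (P i : Set Γ)) = P i

/-- The cusped graph: the Cayley graph of `Γ` with respect to `S` (`g` and `h` are adjacent if
`g⁻¹ * h ∈ S`), to which the horoballs over all the cosets `g (P i)` are glued along their vertices
of height `0`. A coset `g (P i)` is a graph with `h` and `h'` adjacent if `h⁻¹ * h' ∈ S ∩ P i`. For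
a compatible `S` these coset graphs are the connected components of
`SimpleGraph.mulCayley (S ∩ P i)`, so their horoballs form the horoball over that graph. -/
def cuspedGraph (P : I → Subgroup Γ) (S : Set Γ) : SimpleGraph (CuspVertex Γ I) where
  Adj x y :=
    (∃ g h : Γ, x = .base g ∧ y = .base h ∧ (SimpleGraph.mulCayley S).Adj g h) ∨
    (∃ (i : I) (g h : Γ) (m n : ℕ), x = .mk g i m ∧ y = .mk h i n ∧
      (horoballGraph (SimpleGraph.mulCayley (S ∩ (P i : Set Γ)))).Adj (g, m) (h, n))
  symm := ⟨by
    rintro x y (⟨g, h, hx, hy, hgh⟩ | ⟨i, g, h, m, n, hx, hy, hgh⟩)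
    · exact Or.inl ⟨h, g, hy, hx, hgh.symm⟩
    · exact Or.inr ⟨i, h, g, n, m, hy, hx, hgh.symm⟩⟩
  loopless := ⟨by
    rintro x (⟨g, h, hx, hy, hgh⟩ | ⟨i, g, h, m, n, hx, hy, hgh⟩)
    · rw [hx] at hy
      cases hy
      exact hgh.ne rfl
    · rw [hx] at hy
      cases m <;> cases n <;> simp only [CuspVertex.mk] at hy <;> cases hy <;> exact hgh.ne rfl⟩

/-- The vertex set of the `n`-horoball associated with the horoball over the coset `g (P i)`: the
vertices `(h, i, m)` with `h ∈ g (P i)` and `m ≥ n`. -/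
def horoballVertices (P : I → Subgroup Γ) (n : ℕ) (g : Γ) (i : I) : Set (CuspVertex Γ I) :=
  {x | ∃ (h : Γ) (m : ℕ), g⁻¹ * h ∈ P i ∧ n ≤ m ∧ x = .mk h i m}

end CuspedGraph

/-! ### Simplicial complexes and simplicial chains with real coefficients -/

section Simplicial

variable {V : Type u}

/-- The Rips complex `R_κ(G)`: the simplices are the finite nonempty sets of vertices of diameter
at most `κ` in the graph metric. -/
def ripsComplex (G : SimpleGraph V) (κ : ℕ) : AbstractSimplicialComplex V where
  faces := {s | s.Nonempty ∧ ∀ x ∈ s, ∀ y ∈ s, G.edist x y ≤ κ}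
  isRelLowerSet_faces := fun _ hs =>
    ⟨hs.1, fun _ hts ht => ⟨ht, fun x hx y hy => hs.2 x (hts hx) y (hts hy)⟩⟩
  singleton_mem := fun x => ⟨Finset.singleton_nonempty x, by simp⟩

/-- The full subcomplex of `K` spanned by a set `A` of vertices. -/
def fullSubcomplex (K : AbstractSimplicialComplex V) (A : Set V) :
    PreAbstractSimplicialComplex V where
  faces := {s | s ∈ K.faces ∧ (s : Set V) ⊆ A}
  isRelLowerSet_faces := fun _ hs =>
    ⟨(K.isRelLowerSet_faces hs.1).1, fun _ hts ht =>
      ⟨(K.isRelLowerSet_faces hs.1).2 hts ht, fun _ hx => hs.2 (hts hx)⟩⟩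

/-- The `1`-skeleton of `K`, as a graph. -/
def skeletonGraph (K : AbstractSimplicialComplex V) : SimpleGraph V :=
  SimpleGraph.fromRel fun x y => ∃ s ∈ K.faces, x ∈ s ∧ y ∈ s

/-- The neighbourhood `N_r(A)` in `K` of a set `A` of vertices: the full subcomplex spanned by the
vertices at distance at most `r` from `A` in the graph metric of the `1`-skeleton of `K`. -/
def nbhd (K : AbstractSimplicialComplex V) (r : ℕ) (A : Set V) : PreAbstractSimplicialComplex V :=
  fullSubcomplex K {x | ∃ a ∈ A, (skeletonGraph K).edist x a ≤ r}

/-- The real simplicial `k`-chains of `K`, as finitely supported alternating functions on the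
oriented `k`-simplices: `c (x₀, …, x_k)` is the coefficient in `c` of the oriented simplex
`[x₀, …, x_k]`. Being alternating, `c` vanishes on the tuples with repetitions. -/
def chains (K : AbstractSimplicialComplex V) (k : ℕ) :
    Submodule ℝ ((Fin (k + 1) → V) →₀ ℝ) where
  carrier := {c | (∀ (t : Fin (k + 1) → V) (σ : Equiv.Perm (Fin (k + 1))),
      c (t ∘ σ) = ((Equiv.Perm.sign σ : ℤ) : ℝ) * c t) ∧
    ∀ t : Fin (k + 1) → V, c t ≠ 0 → ∃ s ∈ K.faces, (s : Set V) = Set.range t}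
  add_mem' := by
    rintro a b ⟨ha, ha'⟩ ⟨hb, hb'⟩
    refine ⟨fun t σ => by simp only [Finsupp.add_apply, ha, hb, mul_add], fun t ht => ?_⟩
    by_cases h : a t = 0
    · exact hb' t fun h' => ht (by simp [h, h'])
    · exact ha' t h
  zero_mem' := ⟨fun t σ => by simp, fun t ht => absurd rfl ht⟩
  smul_mem' := by
    rintro r a ⟨ha, ha'⟩
    refine ⟨fun t σ => ?_, fun t ht => ha' t fun h => ht (by simp [h])⟩
    simp only [Finsupp.smul_apply, ha, smul_eq_mul]
    ring

/-- The boundary operator. In terms of coefficients, `(∂ c) (x₁, …, x_k)` is the sum over all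
vertices `x` of `c (x, x₁, …, x_k)`; this is the usual operator, which maps `[x₀, …, x_k]` to
`∑ i, (-1) ^ i [x₀, …, x̂_i, …, x_k]`. -/
def boundary (k : ℕ) : ((Fin (k + 1) → V) →₀ ℝ) →ₗ[ℝ] ((Fin k → V) →₀ ℝ) :=
  Finsupp.lmapDomain ℝ ℝ Fin.tail

/-- The space `Z_k(K)` of the `k`-cycles of `K`. -/
def cycles (K : AbstractSimplicialComplex V) (k : ℕ) : Submodule ℝ ((Fin (k + 1) → V) →₀ ℝ) :=
  chains K k ⊓ LinearMap.ker (boundary k)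

/-- The support of a `k`-chain: the set of the (unoriented) simplices with nonzero coefficient. -/
def supp {k : ℕ} (c : (Fin (k + 1) → V) →₀ ℝ) : Set (Finset V) :=
  {s | ∃ t : Fin (k + 1) → V, c t ≠ 0 ∧ (s : Set V) = Set.range t}

/-- The `ℓ¹`-norm of a `k`-chain with respect to the basis of (unoriented) simplices: each of them
is represented by `(k + 1)!` tuples, with the same absolute value of the coefficient. -/
def l1norm {k : ℕ} (c : (Fin (k + 1) → V) →₀ ℝ) : ℝ :=
  (∑ t ∈ c.support, |c t|) / (Nat.factorial (k + 1) : ℝ)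

/-- The height of the highest vertex of the simplices in the support of a chain (`0` if the chain is
zero). -/
def maxh {Γ : Type u} {I : Type v} {k : ℕ} (c : (Fin (k + 1) → CuspVertex Γ I) →₀ ℝ) : ℕ :=
  c.support.sup fun t => Finset.univ.sup fun j => (t j).height

end Simplicial

end CuspedRips

end

/-! A finite union of geodesics in a hyperbolic graph is coarsely one-dimensional, so cycles of
degree at least 2 near it should bound uniformly. Joining the endpoints of the geodesics to a base
point and using slim triangles puts the vertices of `z` near a star of `2 * n` geodesics. Cutting by
the distance to the base point into levels of thickness `κ + 1`, and each level into clusters,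
yields a map `f` of bounded displacement `K` such that three pairwise close vertices never have
three distinct images (`exists_collapse`). An oriented simplex with at least three vertices
therefore goes to zero, so `f` kills `z`, and the prism between the identity and `f` fills `z` up to
sign.

This filling lives in the Rips complex with parameter `κ + 2 * K`. It is brought back to parameter
`κ` by a local chain map that fixes the small simplices, has bounded norm and preserves convex sets
(`exists_localRetract`). That map is built degree by degree, and each extension needs to fill a
cycle of bounded size: the vertex farthest from a centre `w` is pushed repeatedly towards `w`, which
slim triangles allow within the Rips complex, until a cone from `w` is possible (`exists_filling`).

The collapse keeps the vertices in the vertex set of `z`, and the retraction preserves convex sets.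
Hence the last condition reduces to the convexity of the `C`-horoballs
(`geodesicallyConvex_horoballVertices`). All bounds are independent of heights, so `M` can be
constant.

The constructions use ordered chains, with repeated vertices allowed, because vertex maps and prisms
create degenerate simplices. Alternation converts the result to oriented chains. -/

namespace CuspedRips

noncomputable section

universe u v

open Classical Finsupp

/-! ### Ordered chains as words: augmented boundary, vertex maps and prisms. -/

section Words

variable {V : Type u} {α β : Type*}

/-- Ordered real chains of all degrees, as combinations of words in the vertices. -/
abbrev WordChain (V : Type u) := List V →₀ ℝ

/-- The `ℓ¹`-norm of a finitely supported function. -/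
def l1 (c : α →₀ ℝ) : ℝ := ∑ t ∈ c.support, |c t|

lemma l1_eq_sum_of_subset {c : α →₀ ℝ} {s : Finset α} (h : c.support ⊆ s) :
    l1 c = ∑ t ∈ s, |c t| :=
  Finset.sum_subset h fun t _ ht => by simp [Finsupp.notMem_support_iff.1 ht]

lemma l1_nonneg (c : α →₀ ℝ) : 0 ≤ l1 c := Finset.sum_nonneg fun _ _ => abs_nonneg _

@[simp] lemma l1_zero : l1 (0 : α →₀ ℝ) = 0 := by simp [l1]

lemma l1_single (a : α) (r : ℝ) : l1 (single a r) = |r| := by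
  rw [l1_eq_sum_of_subset Finsupp.support_single_subset]
  simp

lemma l1_add_le (c d : α →₀ ℝ) : l1 (c + d) ≤ l1 c + l1 d := by
  rw [l1_eq_sum_of_subset (Finsupp.support_add (g₁ := c) (g₂ := d)),
    l1_eq_sum_of_subset (c := c) (s := c.support ∪ d.support) Finset.subset_union_left,
    l1_eq_sum_of_subset (c := d) (s := c.support ∪ d.support) Finset.subset_union_right,
    ← Finset.sum_add_distrib]
  exact Finset.sum_le_sum fun t _ => by simpa using abs_add_le (c t) (d t)

lemma l1_smul (r : ℝ) (c : α →₀ ℝ) : l1 (r • c) = |r| * l1 c := by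
  rw [l1_eq_sum_of_subset (Finsupp.support_smul (b := r) (g := c)), l1, Finset.mul_sum]
  simp [abs_mul]

lemma l1_neg (c : α →₀ ℝ) : l1 (-c) = l1 c := by
  simp [l1]

lemma l1_sub_le (c d : α →₀ ℝ) : l1 (c - d) ≤ l1 c + l1 d := by
  simpa [sub_eq_add_neg, l1_neg] using l1_add_le c (-d)

lemma l1_sum_le {ι : Type*} (s : Finset ι) (f : ι → α →₀ ℝ) :
    l1 (∑ i ∈ s, f i) ≤ ∑ i ∈ s, l1 (f i) := by
  induction s using Finset.induction_on with
  | empty => simp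
  | insert a s ha ih =>
    rw [Finset.sum_insert ha, Finset.sum_insert ha]
    exact (l1_add_le _ _).trans (by gcongr)

lemma l1_linearCombination_le {φ : α → β →₀ ℝ} {B : ℝ} {c : α →₀ ℝ}
    (h : ∀ a ∈ c.support, l1 (φ a) ≤ B) : l1 (linearCombination ℝ φ c) ≤ B * l1 c := by
  rw [linearCombination_apply, Finsupp.sum, show l1 c = ∑ t ∈ c.support, |c t| from rfl,
    Finset.mul_sum]
  refine (l1_sum_le _ _).trans (Finset.sum_le_sum fun a ha => ?_)
  rw [l1_smul, mul_comm]
  exact mul_le_mul_of_nonneg_right (h a ha) (abs_nonneg _)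

lemma lmapDomain_eq_linearCombination (f : α → β) :
    lmapDomain ℝ ℝ f = linearCombination ℝ fun a => single (f a) (1 : ℝ) := by
  ext a b
  simp

lemma l1_lmapDomain_le (f : α → β) (c : α →₀ ℝ) : l1 (lmapDomain ℝ ℝ f c) ≤ l1 c := by
  rw [lmapDomain_eq_linearCombination, ← one_mul (l1 c)]
  exact l1_linearCombination_le fun a _ => by simp [l1_single]

lemma linearCombination_mem_supported {φ : α → β →₀ ℝ} {s : Set α} {t : Set β}
    (h : ∀ a ∈ s, φ a ∈ supported ℝ ℝ t) {c : α →₀ ℝ} (hc : c ∈ supported ℝ ℝ s) :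
    linearCombination ℝ φ c ∈ supported ℝ ℝ t := by
  rw [linearCombination_apply]
  exact Submodule.sum_mem _ fun a ha => Submodule.smul_mem _ _ (h a (hc ha))

lemma lmapDomain_mem_supported {f : α → β} {s : Set α} {t : Set β}
    (h : ∀ a ∈ s, f a ∈ t) {c : α →₀ ℝ} (hc : c ∈ supported ℝ ℝ s) :
    lmapDomain ℝ ℝ f c ∈ supported ℝ ℝ t := by
  rw [lmapDomain_eq_linearCombination]
  exact linearCombination_mem_supported (fun a ha => single_mem_supported ℝ _ (h a ha)) hc

lemma linearCombination_congr_on {φ ψ : α → β →₀ ℝ} {s : Set α} {c : α →₀ ℝ}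
    (hc : c ∈ supported ℝ ℝ s) (h : ∀ a ∈ s, φ a = ψ a) :
    linearCombination ℝ φ c = linearCombination ℝ ψ c := by
  rw [linearCombination_apply, linearCombination_apply]
  exact Finsupp.sum_congr fun a ha => by rw [h a (hc ha)]

lemma linearCombination_single_one (c : α →₀ ℝ) :
    linearCombination ℝ (fun a => single a (1 : ℝ)) c = c := by
  rw [linearCombination_apply]
  simp

/-- Prepending a letter to all words. -/
def prepend (v : V) : WordChain V →ₗ[ℝ] WordChain V := lmapDomain ℝ ℝ (List.cons v)

@[simp] lemma prepend_single (v : V) (l : List V) (r : ℝ) :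
    prepend v (single l r) = single (v :: l) r := by simp [prepend]

/-- The alternating sum of the faces of a word. -/
def faceSum : List V → WordChain V
  | [] => 0
  | v :: l => single l 1 - prepend v (faceSum l)

/-- The augmented boundary operator of ordered chains. -/
def wordBoundary : WordChain V →ₗ[ℝ] WordChain V := linearCombination ℝ faceSum

@[simp] lemma wordBoundary_single (l : List V) : wordBoundary (single l 1) = faceSum l := by
  simp [wordBoundary]

/-- The cone formula. Because the boundary is augmented (a one-letter word bounds the empty word),
there is no exception in low degree, and every cycle is filled by its cone. -/
lemma wordBoundary_prepend (v : V) (c : WordChain V) :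
    wordBoundary (prepend v c) = c - prepend v (wordBoundary c) := by
  suffices h : wordBoundary ∘ₗ prepend v = LinearMap.id - prepend v ∘ₗ wordBoundary from
    LinearMap.congr_fun h c
  refine Finsupp.lhom_ext' fun l => LinearMap.ext_ring ?_
  simp [faceSum]

lemma wordBoundary_faceSum (l : List V) : wordBoundary (faceSum l) = 0 := by
  induction l with
  | nil => simp [faceSum]
  | cons v l ih => simp [faceSum, wordBoundary_prepend, ih]

/-- The map induced by a map of vertices. -/
def wordMap (f : V → V) : WordChain V →ₗ[ℝ] WordChain V := lmapDomain ℝ ℝ (List.map f)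

@[simp] lemma wordMap_single (f : V → V) (l : List V) (r : ℝ) :
    wordMap f (single l r) = single (l.map f) r := by simp [wordMap]

lemma wordMap_prepend (f : V → V) (v : V) (c : WordChain V) :
    wordMap f (prepend v c) = prepend (f v) (wordMap f c) := by
  suffices h : wordMap f ∘ₗ prepend v = prepend (f v) ∘ₗ wordMap f from LinearMap.congr_fun h c
  refine Finsupp.lhom_ext' fun l => LinearMap.ext_ring ?_
  simp

lemma wordMap_faceSum (f : V → V) (l : List V) :
    wordMap f (faceSum l) = faceSum (l.map f) := by
  induction l with
  | nil => simp [faceSum]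
  | cons v l ih => simp [faceSum, wordMap_prepend, ih]

lemma wordBoundary_wordMap (f : V → V) (c : WordChain V) :
    wordBoundary (wordMap f c) = wordMap f (wordBoundary c) := by
  suffices h : wordBoundary ∘ₗ wordMap f = wordMap f ∘ₗ wordBoundary from LinearMap.congr_fun h c
  refine Finsupp.lhom_ext' fun l => LinearMap.ext_ring ?_
  simp [wordMap_faceSum]

/-- The prism over a word, with respect to a map of vertices. -/
def prismWord (f : V → V) : List V → WordChain V
  | [] => 0
  | v :: l => single (v :: f v :: l.map f) 1 - prepend v (prismWord f l)

/-- The chain homotopy from the identity to the map induced by a map of vertices. -/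
def prism (f : V → V) : WordChain V →ₗ[ℝ] WordChain V := linearCombination ℝ (prismWord f)

@[simp] lemma prism_single (f : V → V) (l : List V) : prism f (single l 1) = prismWord f l := by
  simp [prism]

lemma prism_prepend (f : V → V) (v : V) (c : WordChain V) :
    prism f (prepend v c) = prepend v (prepend (f v) (wordMap f c)) - prepend v (prism f c) := by
  suffices h : prism f ∘ₗ prepend v =
      prepend v ∘ₗ prepend (f v) ∘ₗ wordMap f - prepend v ∘ₗ prism f from LinearMap.congr_fun h c
  refine Finsupp.lhom_ext' fun l => LinearMap.ext_ring ?_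
  simp [prismWord]

lemma wordBoundary_prismWord (f : V → V) (l : List V) :
    wordBoundary (prismWord f l) + prism f (faceSum l) =
      single (l.map f) 1 - single l 1 := by
  induction l with
  | nil => simp [prismWord, faceSum]
  | cons v l ih =>
    have ih' := congrArg (prepend v) ih
    simp only [map_add, map_sub, prepend_single] at ih'
    simp only [prismWord, faceSum, map_sub, wordBoundary_single, wordBoundary_prepend,
      prism_single, prism_prepend, List.map_cons, prepend_single, wordMap_faceSum]
    rw [← sub_eq_zero] at ih' ⊢
    rw [← ih']
    abel

lemma wordBoundary_prism (f : V → V) (c : WordChain V) :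
    wordBoundary (prism f c) + prism f (wordBoundary c) = wordMap f c - c := by
  suffices h : wordBoundary ∘ₗ prism f + prism f ∘ₗ wordBoundary = wordMap f - LinearMap.id from
    LinearMap.congr_fun h c
  refine Finsupp.lhom_ext' fun l => LinearMap.ext_ring ?_
  simp [wordBoundary_prismWord]

lemma faceSum_mem_supported (l : List V) :
    faceSum l ∈ supported ℝ ℝ {l' : List V | l'.length + 1 = l.length ∧ l'.Sublist l} := by
  induction l with
  | nil => simp [faceSum]
  | cons v l ih =>
    refine Submodule.sub_mem _ (single_mem_supported ℝ _ (by simp)) ?_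
    refine lmapDomain_mem_supported ?_ ih
    rintro l' ⟨h, h'⟩
    exact ⟨by simp [h], h'.cons_cons v⟩

lemma l1_faceSum_le (l : List V) : l1 (faceSum l) ≤ l.length := by
  induction l with
  | nil => simp [faceSum]
  | cons v l ih =>
    have := l1_sub_le (single l (1 : ℝ)) (prepend v (faceSum l))
    have h := l1_lmapDomain_le (List.cons v) (faceSum l)
    rw [l1_single, abs_one] at this
    simp only [faceSum, List.length_cons, Nat.cast_add, Nat.cast_one]
    change l1 (prepend v (faceSum l)) ≤ _ at h
    linarith

lemma prismWord_mem_supported (f : V → V) (l : List V) :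
    prismWord f l ∈ supported ℝ ℝ
      {l' : List V | l'.length = l.length + 1 ∧ ∀ x ∈ l', x ∈ l ∨ ∃ y ∈ l, x = f y} := by
  induction l with
  | nil => simp [prismWord]
  | cons v l ih =>
    refine Submodule.sub_mem _ (single_mem_supported ℝ _ ?_) ?_
    · refine ⟨by simp, fun x hx => ?_⟩
      simp only [List.mem_cons, List.mem_map] at hx ⊢
      grind
    · refine lmapDomain_mem_supported ?_ ih
      rintro l' ⟨h, h'⟩
      refine ⟨by simp [h], fun x hx => ?_⟩
      simp only [List.mem_cons] at hx ⊢
      grind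

lemma l1_prismWord_le (f : V → V) (l : List V) : l1 (prismWord f l) ≤ l.length := by
  induction l with
  | nil => simp [prismWord]
  | cons v l ih =>
    have := l1_sub_le (single (v :: f v :: l.map f) (1 : ℝ)) (prepend v (prismWord f l))
    have h := l1_lmapDomain_le (List.cons v) (prismWord f l)
    rw [l1_single, abs_one] at this
    simp only [prismWord, List.length_cons, Nat.cast_add, Nat.cast_one]
    change l1 (prepend v (prismWord f l)) ≤ _ at h
    linarith

end Words

/-! ### Filling cycles on finite vertex sets by pushing towards a centre. -/

section Filling

variable {V : Type u} {G : SimpleGraph V} {δ κ : ℕ}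

/-- The vertex `a` lies on a geodesic from `x` to `y`. -/
def Between (G : SimpleGraph V) (x y a : V) : Prop := G.dist x a + G.dist a y = G.dist x y

lemma Between.symm {x y a : V} (h : Between G x y a) : Between G y x a := by
  have := h
  unfold Between at *
  rw [G.dist_comm (u := y) (v := a), G.dist_comm (u := a) (v := x), G.dist_comm (u := y)]
  omega

/-- Sets containing all geodesics that join their vertices. -/
def GeodesicallyConvex (G : SimpleGraph V) (H : Set V) : Prop :=
  ∀ x ∈ H, ∀ y ∈ H, ∀ a, Between G x y a → a ∈ H

/-- Sets containing all geodesics that join their vertices to `w`. -/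
def GeodesicallyStarConvex (G : SimpleGraph V) (w : V) (H : Set V) : Prop :=
  ∀ x ∈ H, ∀ a, Between G x w a → a ∈ H

lemma GeodesicallyConvex.starConvex {H : Set V} (h : GeodesicallyConvex G H) {w : V}
    (hw : w ∈ H) : GeodesicallyStarConvex G w H := fun x hx a ha => h x hx w hw a ha

lemma geodesicallyStarConvex_ball (w : V) (r : ℕ) :
    GeodesicallyStarConvex G w {x | G.dist x w ≤ r} := by
  intro x hx a ha
  simp only [Between, Set.mem_ofPred_eq] at *
  omega

/-- A reformulation of hyperbolicity in terms of distances. -/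
def ThinTriangles (G : SimpleGraph V) (δ : ℕ) : Prop :=
  ∀ x y z a, Between G x y a → ∃ b, (Between G y z b ∨ Between G x z b) ∧ G.dist a b ≤ δ

lemma between_of_mem_support {x y a : V} {p : G.Walk x y} (hG : G.Connected)
    (hp : p.length = G.dist x y) (ha : a ∈ p.support) : Between G x y a := by
  have h1 := SimpleGraph.dist_le (p.takeUntil a ha)
  have h2 := SimpleGraph.dist_le (p.dropUntil a ha)
  have h3 := congrArg SimpleGraph.Walk.length (p.take_spec ha)
  rw [SimpleGraph.Walk.length_append] at h3
  have h4 := hG.dist_triangle (u := x) (v := a) (w := y)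
  unfold Between
  omega

lemma Between.exists_walk {x y a : V} (hG : G.Connected) (h : Between G x y a) :
    ∃ p : G.Walk x y, p.length = G.dist x y ∧ a ∈ p.support := by
  obtain ⟨p, hp⟩ := hG.exists_walk_length_eq_dist x a
  obtain ⟨q, hq⟩ := hG.exists_walk_length_eq_dist a y
  refine ⟨p.append q, ?_, ?_⟩
  · rw [SimpleGraph.Walk.length_append, hp, hq, h]
  · simp [SimpleGraph.Walk.mem_support_append_iff]

lemma IsHyperbolic.thinTriangles (hG : G.Connected) (h : IsHyperbolic G δ) :
    ThinTriangles G δ := by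
  intro x y z a ha
  obtain ⟨p, hp, hap⟩ := ha.exists_walk hG
  obtain ⟨q, hq⟩ := hG.exists_walk_length_eq_dist y z
  obtain ⟨r, hr⟩ := hG.exists_walk_length_eq_dist x z
  have cast {u v : V} {p : G.Walk u v} (hp : p.length = G.dist u v) :
      (p.length : ℕ∞) = G.edist u v := by rw [hp, (hG u v).coe_dist_eq_edist]
  obtain ⟨b, hb, hab⟩ := h x y z p q r (cast hp) (cast hq) (cast hr) a hap
  refine ⟨b, hb.imp (between_of_mem_support hG hq) (between_of_mem_support hG hr), ?_⟩
  rw [← (hG a b).coe_dist_eq_edist] at hab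
  exact_mod_cast hab

lemma exists_between_dist_eq (hG : G.Connected) (x y : V) {s : ℕ} (hs : s ≤ G.dist x y) :
    ∃ a, Between G x y a ∧ G.dist x a = s := by
  obtain ⟨p, hp⟩ := hG.exists_walk_length_eq_dist x y
  have h1 := SimpleGraph.dist_le (p.take s)
  have h2 := SimpleGraph.dist_le (p.drop s)
  have h4 := hG.dist_triangle (u := x) (v := p.getVert s) (w := y)
  rw [SimpleGraph.Walk.take_length] at h1
  rw [SimpleGraph.Walk.drop_length] at h2
  have : min s p.length = s := by omega
  refine ⟨p.getVert s, ?_, ?_⟩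
  · unfold Between
    omega
  · omega

/-- Pushing the vertex `v` towards `w` does not increase the distances to the vertices which are
not farther from `w`, as long as these are large. -/
lemma dist_push_le (hG : G.Connected) (hδ : ThinTriangles G δ) (hκ : 4 * δ + 6 ≤ κ)
    {u v v' w : V} (huv : G.dist u v ≤ κ) (hw : G.dist u w ≤ G.dist v w)
    (hv : Between G v w v') (hv' : G.dist v v' = 2 * δ + 1) : G.dist u v' ≤ κ := by
  -- If `b` lies on `[v, u]`, then `b` is at least `δ + 1` closer to `u` than `v` is, so `v'` is
  -- closer to `u` than `v`. If `b` lies on `[w, u]`, comparing distances to `w` gives `d(u, b) ≤ 3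
  -- * δ + 1`, hence `d(u, v') ≤ 4 * δ + 1 ≤ κ`.
  obtain ⟨b, hb, hb'⟩ := hδ v w u v' hv
  have h1 := hG.dist_triangle (u := u) (v := b) (w := v')
  have h2 := hG.dist_triangle (u := v) (v := b) (w := v')
  have h3 := hG.dist_triangle (u := v') (v := b) (w := w)
  have h4 := G.dist_comm (u := b) (v := v')
  have h5 := G.dist_comm (u := b) (v := u)
  have h6 := G.dist_comm (u := b) (v := w)
  have h7 := G.dist_comm (u := v) (v := u)
  have h8 := G.dist_comm (u := w) (v := u)
  unfold Between at hb hv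
  omega

/-- The words of length `m` in the vertices in `B`, any two of which are at distance at most `κ`. -/
def smallWords (G : SimpleGraph V) (κ m : ℕ) (B : Set V) : Set (List V) :=
  {l | l.length = m ∧ (∀ x ∈ l, ∀ y ∈ l, G.dist x y ≤ κ) ∧ ∀ x ∈ l, x ∈ B}

lemma smallWords_mono {m : ℕ} {A B : Set V} (h : A ⊆ B) :
    smallWords G κ m A ⊆ smallWords G κ m B := fun _ hl =>
  ⟨hl.1, hl.2.1, fun x hx => h (hl.2.2 x hx)⟩

lemma cone_filling {m : ℕ} {A : Finset V} {w : V}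
    (hA : ∀ x ∈ A, G.dist x w ≤ κ) {z : WordChain V}
    (hz : z ∈ supported ℝ ℝ (smallWords G κ m A)) (hz' : wordBoundary z = 0) :
    prepend w z ∈ supported ℝ ℝ (smallWords G κ (m + 1) (insert w A : Finset V)) ∧
      wordBoundary (prepend w z) = z ∧ l1 (prepend w z) ≤ l1 z := by
  refine ⟨lmapDomain_mem_supported ?_ hz, by simp [wordBoundary_prepend, hz'],
    l1_lmapDomain_le _ _⟩
  rintro l ⟨hl, hl', hl''⟩
  refine ⟨by simp [hl], fun x hx y hy => ?_, fun x hx => ?_⟩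
  · rw [List.mem_cons] at hx hy
    rcases hx with rfl | hx <;> rcases hy with rfl | hy
    · simp
    · rw [SimpleGraph.dist_comm]
      exact hA y (hl'' y hy)
    · exact hA x (hl'' x hx)
    · exact hl' x hx y hy
  · rw [List.mem_cons] at hx
    rw [Finset.mem_coe, Finset.mem_insert]
    exact hx.imp_right fun hx => hl'' x hx

/-- Filling of cycles in the Rips complex, by pushing the vertices towards `w`. -/
lemma exists_filling (hG : G.Connected) (hδ : ThinTriangles G δ) (hκ : 4 * δ + 6 ≤ κ) (m : ℕ)
    (w : V) (s : ℕ) : ∀ (A : Finset V), ∑ x ∈ A, G.dist x w ≤ s → ∀ z : WordChain V,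
      z ∈ supported ℝ ℝ (smallWords G κ m A) → wordBoundary z = 0 →
      ∃ (a : WordChain V) (B : Finset V), A ⊆ B ∧ B.card ≤ A.card + s + 1 ∧
        (∀ H : Set V, GeodesicallyStarConvex G w H → w ∈ H → (A : Set V) ⊆ H → (B : Set V) ⊆ H) ∧
        a ∈ supported ℝ ℝ (smallWords G κ (m + 1) B) ∧ wordBoundary a = z ∧
        l1 a ≤ (s * m + 1) * l1 z := by
  induction s with
  | zero =>
    intro A hA z hz hz'
    have hA' : ∀ x ∈ A, G.dist x w ≤ κ := fun x hx =>
      (Finset.single_le_sum (f := fun x => G.dist x w) (fun _ _ => Nat.zero_le _) hx).trans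
        (hA.trans (Nat.zero_le _))
    obtain ⟨h1, h2, h3⟩ := cone_filling hA' hz hz'
    refine ⟨prepend w z, insert w A, Finset.subset_insert _ _, Finset.card_insert_le _ _, ?_, h1,
      h2, by simpa using h3⟩
    intro H _ hw hAH
    rw [Finset.coe_insert]
    exact Set.insert_subset hw hAH
  | succ s ih =>
    intro A hA z hz hz'
    by_cases hA' : ∀ x ∈ A, G.dist x w ≤ κ
    · obtain ⟨h1, h2, h3⟩ := cone_filling hA' hz hz'
      refine ⟨prepend w z, insert w A, Finset.subset_insert _ _,
        (Finset.card_insert_le _ _).trans (by omega), ?_, h1, h2, h3.trans ?_⟩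
      · intro H _ hw hAH
        rw [Finset.coe_insert]
        exact Set.insert_subset hw hAH
      · have := l1_nonneg z
        refine le_mul_of_one_le_left this ?_
        have : (0 : ℝ) ≤ ((s + 1 : ℕ) : ℝ) * m := by positivity
        linarith
    push Not at hA'
    obtain ⟨x₀, hx₀, hx₀'⟩ := hA'
    -- Only the farthest vertex is moved: maximality is what `dist_push_le` requires of all its
    -- neighbours. The move lowers the total distance to `w`, on which the induction runs.
    obtain ⟨v, hv, hmax⟩ := A.exists_max_image (fun x => G.dist x w) ⟨x₀, hx₀⟩
    have hvκ : κ < G.dist v w := hx₀'.trans_le (hmax x₀ hx₀)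
    obtain ⟨v', hbet, hv'⟩ := exists_between_dist_eq hG v w (s := 2 * δ + 1) (by omega)
    set f : V → V := Function.update id v v' with hf
    have hfv : f v = v' := by simp [hf]
    have hfne : ∀ x, x ≠ v → f x = x := fun x hx => by simp [hf, hx]
    have hpush : ∀ u ∈ A, G.dist u v ≤ κ → G.dist u v' ≤ κ := fun u hu huv =>
      dist_push_le hG hδ hκ huv (hmax u hu) hbet hv'
    have hpush1 : ∀ x ∈ A, ∀ y ∈ A, G.dist x y ≤ κ → G.dist x (f y) ≤ κ := by
      intro x hx y hy hxy
      by_cases h : y = v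
      · subst h
        rw [hfv]
        exact hpush x hx hxy
      · rwa [hfne y h]
    have hpush2 : ∀ x ∈ A, ∀ y ∈ A, G.dist x y ≤ κ → G.dist (f x) (f y) ≤ κ := by
      intro x hx y hy hxy
      by_cases h : x = v
      · by_cases h' : y = v
        · simp [h, h']
        · rw [hfne y h', SimpleGraph.dist_comm]
          exact hpush1 y hy x hx (by rwa [SimpleGraph.dist_comm])
      · rw [hfne x h]
        exact hpush1 x hx y hy hxy
    have hsub : A.image f ⊆ insert v' (A.erase v) := by
      intro x hx
      obtain ⟨y, hy, rfl⟩ := Finset.mem_image.1 hx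
      by_cases h : y = v
      · simp [h, hfv]
      · rw [hfne y h]
        simp [h, hy]
    have hsum : ∑ x ∈ A.image f, G.dist x w ≤ s := by
      have h1 := Finset.sum_le_sum_of_subset (f := fun x => G.dist x w) hsub
      have h2 : ∑ x ∈ insert v' (A.erase v), G.dist x w ≤
          G.dist v' w + ∑ x ∈ A.erase v, G.dist x w := by
        by_cases h : v' ∈ A.erase v
        · rw [Finset.insert_eq_self.2 h]
          omega
        · rw [Finset.sum_insert h]
      have h3 := Finset.add_sum_erase A (fun x => G.dist x w) hv
      unfold Between at hbet
      omega
    have hz1 : wordMap f z ∈ supported ℝ ℝ (smallWords G κ m (A.image f : Finset V)) := by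
      refine lmapDomain_mem_supported ?_ hz
      rintro l ⟨hl, hl', hl''⟩
      refine ⟨by simpa using hl, ?_, ?_⟩
      · intro x hx y hy
        obtain ⟨x, hx', rfl⟩ := List.mem_map.1 hx
        obtain ⟨y, hy', rfl⟩ := List.mem_map.1 hy
        exact hpush2 x (hl'' x hx') y (hl'' y hy') (hl' x hx' y hy')
      · intro x hx
        obtain ⟨x, hx', rfl⟩ := List.mem_map.1 hx
        exact Finset.mem_coe.2 (Finset.mem_image_of_mem f (hl'' x hx'))
    obtain ⟨a, B, hAB, hcard, hH, ha, ha', hal⟩ := ih (A.image f) hsum (wordMap f z) hz1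
      (by rw [wordBoundary_wordMap, hz', map_zero])
    have hAB' : A ⊆ insert v B := by
      intro x hx
      by_cases h : x = v
      · simp [h]
      · refine Finset.mem_insert_of_mem (hAB ?_)
        rw [← hfne x h]
        exact Finset.mem_image_of_mem f hx
    have hfB : ∀ x ∈ A, f x ∈ insert v B := fun x hx =>
      Finset.mem_insert_of_mem (hAB (Finset.mem_image_of_mem f hx))
    -- Since `z` is a cycle, the prism has boundary `wordMap f z - z`, and `a` fills `wordMap f z`.
    -- Each push costs one new vertex and at most `m * l1 z` in norm.
    refine ⟨a - prism f z, insert v B, hAB', ?_, ?_, ?_, ?_, ?_⟩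
    · have h1 := Finset.card_insert_le v B
      have h2 := Finset.card_image_le (s := A) (f := f)
      omega
    · intro H hst hw hAH
      rw [Finset.coe_insert]
      refine Set.insert_subset (hAH hv) (hH H hst hw ?_)
      intro x hx
      obtain ⟨y, hy, rfl⟩ := Finset.mem_image.1 hx
      by_cases h : y = v
      · rw [h, hfv]
        exact hst v (hAH hv) v' hbet
      · rw [hfne y h]
        exact hAH hy
    · refine Submodule.sub_mem _ (supported_mono (smallWords_mono ?_) ha) ?_
      · exact Finset.coe_subset.2 (Finset.subset_insert _ _)
      · refine linearCombination_mem_supported (fun l hl => ?_) hz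
        obtain ⟨hl, hl', hl''⟩ := hl
        refine supported_mono ?_ (prismWord_mem_supported f l)
        rintro l₁ ⟨h1, h2⟩
        refine ⟨by rw [h1, hl], fun x hx y hy => ?_, fun x hx => ?_⟩
        · rcases h2 x hx with hx' | ⟨x, hx', rfl⟩ <;> rcases h2 y hy with hy' | ⟨y, hy', rfl⟩
          · exact hl' x hx' y hy'
          · exact hpush1 x (hl'' x hx') y (hl'' y hy') (hl' x hx' y hy')
          · rw [SimpleGraph.dist_comm]
            exact hpush1 y (hl'' y hy') x (hl'' x hx') (hl' y hy' x hx')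
          · exact hpush2 x (hl'' x hx') y (hl'' y hy') (hl' x hx' y hy')
        · rcases h2 x hx with hx' | ⟨x, hx', rfl⟩
          · exact Finset.mem_coe.2 (hAB' (hl'' x hx'))
          · exact Finset.mem_coe.2 (hfB x (hl'' x hx'))
    · have := wordBoundary_prism f z
      rw [hz', map_zero, add_zero] at this
      rw [map_sub, ha', this, sub_sub_cancel]
    · have h1 := l1_sub_le a (prism f z)
      have h2 : l1 (prism f z) ≤ m * l1 z := by
        refine l1_linearCombination_le fun l hl => ?_
        have := l1_prismWord_le f l
        rwa [(hz hl).1] at this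
      have h3 : l1 (wordMap f z) ≤ l1 z := l1_lmapDomain_le _ _
      have h4 : ((s : ℝ) * m + 1) * l1 (wordMap f z) ≤ (s * m + 1) * l1 z := by gcongr
      push_cast
      linarith

end Filling

/-! ### Retracting a large Rips complex to a smaller one. -/

section Retraction

variable {V : Type u} {G : SimpleGraph V} {δ κ : ℕ}

/-- The properties of the value at the word `l` of a chain map from the chains of a large Rips
complex to those of the Rips complex with parameter `κ`: it is the identity on small words, and its
values have size at most `N` and lie within distance `r`, and in every convex set which contains the
given word. -/
structure IsLocalRetract (G : SimpleGraph V) (κ N r : ℕ) (θ : List V → WordChain V) (l : List V) :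
    Prop where
  boundary : wordBoundary (θ l) = linearCombination ℝ θ (faceSum l)
  eq_single : (∀ x ∈ l, ∀ y ∈ l, G.dist x y ≤ κ) → θ l = single l 1
  l1_le : l1 (θ l) ≤ N
  exists_finset : ∃ B : Finset V, B.card ≤ N ∧ θ l ∈ supported ℝ ℝ (smallWords G κ l.length B) ∧
    (∀ H, GeodesicallyConvex G H → (∀ x ∈ l, x ∈ H) → (B : Set V) ⊆ H) ∧
    ∀ b ∈ B, ∀ x ∈ l, G.dist b x ≤ r

lemma card_support_faceSum_le (l : List V) : (faceSum l).support.card ≤ l.length := by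
  induction l with
  | nil => simp [faceSum]
  | cons v l ih =>
    have h1 : (faceSum (v :: l)).support ⊆ {l} ∪ (faceSum l).support.image (List.cons v) := by
      refine (Finsupp.support_sub).trans (Finset.union_subset_union ?_ ?_)
      · exact Finsupp.support_single_subset
      · exact Finsupp.mapDomain_support
    refine (Finset.card_le_card h1).trans ((Finset.card_union_le _ _).trans ?_)
    have := Finset.card_image_le (s := (faceSum l).support) (f := List.cons v)
    simp only [Finset.card_singleton, List.length_cons]
    omega

lemma isLocalRetract_single {θ : List V → WordChain V} {N r : ℕ} {l : List V} (hN : l.length < N)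
    (hr : κ ≤ r) (hl : ∀ x ∈ l, ∀ y ∈ l, G.dist x y ≤ κ) (hθ : θ l = single l 1)
    (hθ' : ∀ l' : List V, l'.length + 1 = l.length → (∀ x ∈ l', ∀ y ∈ l', G.dist x y ≤ κ) →
      θ l' = single l' 1) : IsLocalRetract G κ N r θ l := by
  refine ⟨?_, fun _ => hθ, ?_, l.toFinset, (List.toFinset_card_le l).trans hN.le, ?_, ?_, ?_⟩
  · rw [hθ, wordBoundary_single]
    refine (linearCombination_single_one (faceSum l)).symm.trans ?_
    refine (linearCombination_congr_on (faceSum_mem_supported l) ?_).symm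
    rintro l' ⟨h, h'⟩
    exact hθ' l' h fun x hx y hy => hl x (h'.subset hx) y (h'.subset hy)
  · rw [hθ, l1_single, abs_one]
    exact_mod_cast (Nat.zero_le _).trans_lt hN
  · rw [hθ]
    exact single_mem_supported ℝ _ ⟨rfl, hl, fun x hx => by simpa using hx⟩
  · intro H _ h x hx
    exact h x (by simpa using hx)
  · intro b hb x hx
    exact (hl b (by simpa using hb) x hx).trans hr

/-- The chains of a large Rips complex can be retracted to those of a smaller one, by a local chain
map of bounded norm which preserves convex sets. -/
lemma exists_localRetract (hG : G.Connected) (hδ : ThinTriangles G δ) (hκ : 4 * δ + 6 ≤ κ)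
    (κ' : ℕ) (hκ' : κ ≤ κ') (d : ℕ) : ∃ (θ : List V → WordChain V) (N r : ℕ), ∀ l : List V,
      l.length ≤ d → (∀ x ∈ l, ∀ y ∈ l, G.dist x y ≤ κ') → IsLocalRetract G κ N r θ l := by
  induction d with
  | zero =>
    refine ⟨fun l => single l 1, 1, κ, fun l hl _ => ?_⟩
    obtain rfl : l = [] := List.eq_nil_of_length_eq_zero (by omega)
    exact isLocalRetract_single (by simp) le_rfl (by simp) rfl fun _ _ _ => rfl
  | succ d ih =>
    obtain ⟨θ, N, r, h⟩ := ih
    set A : List V → Finset V := fun l => if h' : l.length ≤ d ∧ ∀ x ∈ l, ∀ y ∈ l, G.dist x y ≤ κ'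
      then (h l h'.1 h'.2).exists_finset.choose else ∅ with hA
    have hAspec : ∀ l : List V, l.length ≤ d → (∀ x ∈ l, ∀ y ∈ l, G.dist x y ≤ κ') →
        (A l).card ≤ N ∧ θ l ∈ supported ℝ ℝ (smallWords G κ l.length (A l)) ∧
        (∀ H, GeodesicallyConvex G H → (∀ x ∈ l, x ∈ H) → (A l : Set V) ⊆ H) ∧
        ∀ b ∈ A l, ∀ x ∈ l, G.dist b x ≤ r := by
      intro l h1 h2
      have h' : l.length ≤ d ∧ ∀ x ∈ l, ∀ y ∈ l, G.dist x y ≤ κ' := ⟨h1, h2⟩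
      rw [show A l = (h l h1 h2).exists_finset.choose from dif_pos h']
      exact (h l h1 h2).exists_finset.choose_spec
    -- A word of length `d + 1` has at most `d + 1` faces, so `c` bounds both the number of vertices
    -- and the norm of the cycle to be filled. Its vertices are within `r + κ'` of any letter of the
    -- word, so `s` bounds their total distance to the centre.
    set c : ℕ := (d + 1) * N with hc
    set s : ℕ := c * (r + κ') with hs
    set N' : ℕ := max (max (c + s + 1) ((s * d + 1) * c)) (max N (d + 2)) with hN'
    set r' : ℕ := r + 2 * κ' with hr'
    have key : ∀ l : List V, l.length = d + 1 → (∀ x ∈ l, ∀ y ∈ l, G.dist x y ≤ κ') →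
        ¬ (∀ x ∈ l, ∀ y ∈ l, G.dist x y ≤ κ) → ∃ a : WordChain V,
          wordBoundary a = linearCombination ℝ θ (faceSum l) ∧ l1 a ≤ N' ∧
          ∃ B : Finset V, B.card ≤ N' ∧ a ∈ supported ℝ ℝ (smallWords G κ l.length B) ∧
          (∀ H, GeodesicallyConvex G H → (∀ x ∈ l, x ∈ H) → (B : Set V) ⊆ H) ∧
          ∀ b ∈ B, ∀ x ∈ l, G.dist b x ≤ r' := by
      intro l hl hlκ' hlκ
      have hface : ∀ l' ∈ (faceSum l).support, l'.length = d ∧ l' ⊆ l ∧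
          ∀ x ∈ l', ∀ y ∈ l', G.dist x y ≤ κ' := by
        intro l' hl'
        obtain ⟨h1, h2⟩ := faceSum_mem_supported l hl'
        exact ⟨by omega, h2.subset, fun x hx y hy => hlκ' x (h2.subset hx) y (h2.subset hy)⟩
      -- One-letter words have diameter zero and are already small. Thus the faces below are
      -- non-empty, which the distance estimate needs.
      have hd : 1 ≤ d := by
        by_contra hd
        obtain rfl : d = 0 := by omega
        obtain ⟨v, rfl⟩ := List.length_eq_one_iff.1 hl
        exact hlκ (by simp)
      obtain ⟨w, hw⟩ : ∃ w, w ∈ l := List.exists_mem_of_length_pos (by omega)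
      set E : Finset V := (faceSum l).support.biUnion A with hE
      set z := linearCombination ℝ θ (faceSum l) with hz
      have hEcard : E.card ≤ c := by
        refine (Finset.card_biUnion_le_card_mul _ _ N fun l' hl' => ?_).trans ?_
        · obtain ⟨h1, -, h3⟩ := hface l' hl'
          exact (hAspec l' h1.le h3).1
        · exact Nat.mul_le_mul_right _ (hl ▸ card_support_faceSum_le l)
      have hEdist : ∀ b ∈ E, G.dist b w ≤ r + κ' := by
        intro b hb
        obtain ⟨l', hl', hb'⟩ := Finset.mem_biUnion.1 hb
        obtain ⟨h1, h2, h3⟩ := hface l' hl'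
        obtain ⟨x, hx⟩ : ∃ x, x ∈ l' := List.exists_mem_of_length_pos (by omega)
        have h4 := (hAspec l' h1.le h3).2.2.2 b hb' x hx
        have h5 := hlκ' x (h2 hx) w hw
        have h6 := hG.dist_triangle (u := b) (v := x) (w := w)
        omega
      have hEsum : ∑ b ∈ E, G.dist b w ≤ s := by
        refine (Finset.sum_le_card_nsmul _ _ _ hEdist).trans ?_
        rw [smul_eq_mul]
        exact Nat.mul_le_mul_right _ hEcard
      have hzE : z ∈ supported ℝ ℝ (smallWords G κ d E) := by
        rw [hz, linearCombination_apply]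
        refine Submodule.sum_mem _ fun l' hl' => Submodule.smul_mem _ _ ?_
        obtain ⟨h1, h2, h3⟩ := hface l' hl'
        have := (hAspec l' h1.le h3).2.1
        rw [h1] at this
        refine supported_mono (smallWords_mono ?_) this
        exact Finset.coe_subset.2 (Finset.subset_biUnion_of_mem A hl')
      have hz0 : wordBoundary z = 0 := by
        have h1 : wordBoundary z = linearCombination ℝ θ (wordBoundary (faceSum l)) := by
          rw [hz, linearCombination_apply, Finsupp.sum, map_sum, wordBoundary,
            linearCombination_apply ℝ (faceSum l), Finsupp.sum, map_sum]
          refine Finset.sum_congr rfl fun l' hl' => ?_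
          obtain ⟨h1, h2, h3⟩ := hface l' hl'
          rw [map_smul, map_smul]
          congr 1
          exact (h l' h1.le h3).boundary
        rw [h1, wordBoundary_faceSum, map_zero]
      have hzl1 : l1 z ≤ c := by
        refine (l1_linearCombination_le (B := N) fun l' hl' => ?_).trans ?_
        · obtain ⟨h1, h2, h3⟩ := hface l' hl'
          exact (h l' h1.le h3).l1_le
        · have := l1_faceSum_le l
          rw [hl] at this
          rw [hc, Nat.cast_mul, mul_comm]
          gcongr
      obtain ⟨a, B, -, hBcard, hBH, ha, ha', hal1⟩ :=
        exists_filling hG hδ hκ d w s E hEsum z hzE hz0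
      refine ⟨a, ha', ?_, B, ?_, by rwa [hl], ?_, ?_⟩
      · calc l1 a ≤ (s * d + 1) * l1 z := hal1
          _ ≤ (s * d + 1) * c := by gcongr
          _ = ((s * d + 1) * c : ℕ) := by push_cast; ring
          _ ≤ N' := by
            exact_mod_cast (le_max_right _ _).trans (le_max_left _ _)
      · refine le_trans ?_ ((le_max_left (c + s + 1) ((s * d + 1) * c)).trans (le_max_left _ _))
        omega
      · intro H hH hlH
        refine hBH H (hH.starConvex (hlH w hw)) (hlH w hw) fun x hx => ?_
        obtain ⟨l', hl', hx'⟩ := Finset.mem_biUnion.1 (Finset.mem_coe.1 hx)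
        obtain ⟨h1, h2, h3⟩ := hface l' hl'
        exact (hAspec l' h1.le h3).2.2.1 H hH (fun y hy => hlH y (h2 hy)) hx'
      -- The filling stays in the ball of radius `r + κ'` about `w`, as balls are star convex about
      -- their centre. Passing from `w` to another letter costs a further `κ'`.
      · intro b hb x hx
        have h1 : G.dist b w ≤ r + κ' := hBH _ (geodesicallyStarConvex_ball w (r + κ')) (by simp)
          hEdist hb
        have h2 := hlκ' w hw x hx
        have h3 := hG.dist_triangle (u := b) (v := w) (w := x)
        omega
    choose! τ hτ hτ1 hτ2 using key
    -- Small words must be fixed in the new degree as well. In the old degrees this first case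
    -- agrees with `θ`, by `eq_single`.
    set θ' : List V → WordChain V := fun l =>
      if ∀ x ∈ l, ∀ y ∈ l, G.dist x y ≤ κ then single l 1
      else if l.length ≤ d then θ l else τ l with hθ'
    have hθ'1 : ∀ l : List V, (∀ x ∈ l, ∀ y ∈ l, G.dist x y ≤ κ) → θ' l = single l 1 :=
      fun l hl => if_pos hl
    have hθ'2 : ∀ l : List V, l.length ≤ d → (∀ x ∈ l, ∀ y ∈ l, G.dist x y ≤ κ') → θ' l = θ l := by
      intro l hl hlκ'
      by_cases hlκ : ∀ x ∈ l, ∀ y ∈ l, G.dist x y ≤ κ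
      · rw [hθ'1 l hlκ, (h l hl hlκ').eq_single hlκ]
      · exact (if_neg hlκ).trans (if_pos hl)
    have hθ'face : ∀ l : List V, l.length ≤ d + 1 → (∀ x ∈ l, ∀ y ∈ l, G.dist x y ≤ κ') →
        linearCombination ℝ θ' (faceSum l) = linearCombination ℝ θ (faceSum l) := by
      intro l hl hlκ'
      refine linearCombination_congr_on (faceSum_mem_supported l) ?_
      rintro l' ⟨h1, h2⟩
      exact hθ'2 l' (by omega) fun x hx y hy => hlκ' x (h2.subset hx) y (h2.subset hy)
    refine ⟨θ', N', r', fun l hl hlκ' => ?_⟩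
    have hdN : d + 2 ≤ N' := (le_max_right _ _).trans (le_max_right _ _)
    by_cases hlκ : ∀ x ∈ l, ∀ y ∈ l, G.dist x y ≤ κ
    · exact isLocalRetract_single (by omega) (by omega) hlκ (hθ'1 l hlκ) fun l' _ => hθ'1 l'
    by_cases hld : l.length ≤ d
    · obtain ⟨h1, -, h3, B, h4, h5, h6, h7⟩ := h l hld hlκ'
      have hNN : N ≤ N' := (le_max_left _ _).trans (le_max_right _ _)
      refine ⟨?_, fun hh => absurd hh hlκ, ?_, B, h4.trans hNN, ?_, h6, fun b hb x hx => ?_⟩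
      · rw [hθ'face l hl hlκ', hθ'2 l hld hlκ', h1]
      · rw [hθ'2 l hld hlκ']
        exact h3.trans (by exact_mod_cast hNN)
      · rwa [hθ'2 l hld hlκ']
      · exact (h7 b hb x hx).trans (by omega)
    · have hl' : l.length = d + 1 := by omega
      have hθτ : θ' l = τ l := (if_neg hlκ).trans (if_neg hld)
      refine ⟨?_, fun hh => absurd hh hlκ, ?_, ?_⟩
      · rw [hθ'face l hl hlκ', hθτ, hτ l hl' hlκ' hlκ]
      · rw [hθτ]
        exact hτ1 l hl' hlκ' hlκ
      · rw [hθτ]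
        exact hτ2 l hl' hlκ' hlκ

end Retraction

/-! ### Collapsing a neighbourhood of geodesics to a one-dimensional picture. -/

section Collapse

variable {V : Type u} {G : SimpleGraph V} {δ κ : ℕ}

/-- The vertices `a` and `b` may lie on different geodesics. Slimness of the triangle `x, y, b`
gives `c` within `δ` of `a` on a side ending at `b`, and comparing distances to the other end of
that side gives `d(c, b) ≤ m + δ`. -/
lemma dist_le_of_between (hG : G.Connected) (hδ : ThinTriangles G δ) {x y a b : V} {m : ℕ}
    (ha : Between G x y a) (hb : Between G x y b) (h : G.dist x a ≤ G.dist x b + m)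
    (h' : G.dist x b ≤ G.dist x a + m) : G.dist a b ≤ m + 2 * δ := by
  obtain ⟨c, hc, hac⟩ := hδ x y b a ha
  have h1 := hG.dist_triangle (u := a) (v := c) (w := b)
  have h2 := hG.dist_triangle (u := x) (v := c) (w := a)
  have h3 := hG.dist_triangle (u := y) (v := c) (w := a)
  have h4 := G.dist_comm (u := c) (v := a)
  have h5 := G.dist_comm (u := y) (v := a)
  have h6 := G.dist_comm (u := y) (v := b)
  unfold Between at *
  omega

/-- A set of vertices near `n` geodesics can be mapped to itself, with bounded displacement, so that
any three vertices which are close to each other are not mapped to three distinct vertices. -/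
lemma exists_collapse (hG : G.Connected) (hδ : ThinTriangles G δ) (κ n L : ℕ) :
    ∃ K : ℕ, ∀ (p q : Fin n → V) (W : Set V),
      (∀ x ∈ W, ∃ j a, Between G (p j) (q j) a ∧ G.dist x a ≤ L) →
      ∃ f : V → V, (∀ x ∈ W, f x ∈ W ∧ G.dist x (f x) ≤ K) ∧
        ∀ x ∈ W, ∀ y ∈ W, ∀ z ∈ W, G.dist x y ≤ κ → G.dist y z ≤ κ → G.dist x z ≤ κ →
          f x = f y ∨ f y = f z ∨ f x = f z := by
  set L₁ := L + δ with hL₁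
  set D := 2 * L₁ + (κ + 1 + 2 * L₁) + 2 * δ with hD
  -- `D` bounds the distance of two vertices with the same level and column. A cluster is traversed
  -- by a path through fewer than `2 * n` changes of column, each costing at most `κ + D`.
  refine ⟨D + 2 * n * (κ + D), fun p q W hW => ?_⟩
  obtain rfl | ⟨x₀, hx₀⟩ := W.eq_empty_or_nonempty
  · exact ⟨id, by simp, by simp⟩
  have w : V := x₀
  have : Nonempty V := ⟨w⟩
  have : Nonempty (Fin n × Bool) := ⟨((hW x₀ hx₀).choose, true)⟩
  set e : Fin n × Bool → V := fun j => if j.2 then p j.1 else q j.1 with he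
  -- Slim triangles replace the `n` geodesics by `2 * n` geodesics issuing from `w`. The index of
  -- such a geodesic near `x` is the column of `x`.
  have hcol : ∀ x ∈ W, ∃ (j : Fin n × Bool) (b : V), Between G w (e j) b ∧ G.dist x b ≤ L₁ := by
    intro x hx
    obtain ⟨j, a, ha, hxa⟩ := hW x hx
    obtain ⟨b, hb, hab⟩ := hδ (p j) (q j) w a ha
    have h1 := hG.dist_triangle (u := x) (v := a) (w := b)
    rcases hb with hb | hb
    · exact ⟨(j, false), b, by simpa [he] using hb.symm, by omega⟩
    · exact ⟨(j, true), b, by simpa [he] using hb.symm, by omega⟩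
  choose! col b hb hxb using hcol
  set lev : V → ℕ := fun x => G.dist w x / (κ + 1) with hlev
  have hlevle : ∀ x y, G.dist x y ≤ κ → lev x ≤ lev y + 1 := by
    intro x y hxy
    have h1 := hG.dist_triangle (u := w) (v := y) (w := x)
    rw [G.dist_comm (u := y)] at h1
    have h2 : G.dist w x ≤ G.dist w y + (κ + 1) := by omega
    have h3 := Nat.div_le_div_right (c := κ + 1) h2
    rwa [Nat.add_div_right _ (Nat.succ_pos κ)] at h3
  have hlevel : ∀ x y, lev x = lev y → G.dist w x ≤ G.dist w y + (κ + 1) := by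
    intro x y hxy
    have h1 := Nat.div_add_mod (G.dist w x) (κ + 1)
    have h2 := Nat.div_add_mod (G.dist w y) (κ + 1)
    have h3 := Nat.mod_lt (G.dist w x) (show 0 < κ + 1 by omega)
    simp only [hlev] at hxy
    rw [hxy] at h1
    omega
  have hsame : ∀ x ∈ W, ∀ y ∈ W, lev x = lev y → col x = col y → G.dist x y ≤ D := by
    intro x hx y hy hxy hc
    have h1 := hxb x hx
    have h2 := hxb y hy
    have h3 := hG.dist_triangle (u := x) (v := b x) (w := y)
    have h4 := hG.dist_triangle (u := b x) (v := b y) (w := y)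
    have h5 := hlevel x y hxy
    have h6 := hlevel y x hxy.symm
    have h7 := hG.dist_triangle (u := w) (v := x) (w := b x)
    have h8 := hG.dist_triangle (u := w) (v := y) (w := b y)
    have h9 := hG.dist_triangle (u := w) (v := b x) (w := x)
    have h10 := hG.dist_triangle (u := w) (v := b y) (w := y)
    have h11 := G.dist_comm (u := b x) (v := x)
    have h12 := G.dist_comm (u := b y) (v := y)
    have h13 := dist_le_of_between hG hδ (m := κ + 1 + 2 * L₁) (hb x hx)
      (by rw [hc]; exact hb y hy) (by omega) (by omega)
    omega
  -- Columns are joined at level `m` when they contain close vertices of this level. The components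
  -- of this graph make the clusters transitive while keeping their diameter bounded.
  set Q : ℕ → SimpleGraph (Fin n × Bool) := fun m => SimpleGraph.fromRel fun i j =>
    ∃ x ∈ W, ∃ y ∈ W, lev x = m ∧ lev y = m ∧ col x = i ∧ col y = j ∧ G.dist x y ≤ κ with hQ
  have hQadj : ∀ m i j, (Q m).Adj i j → ∃ x ∈ W, ∃ y ∈ W, lev x = m ∧ lev y = m ∧ col x = i ∧
      col y = j ∧ G.dist x y ≤ κ := by
    rintro m i j ⟨-, h | ⟨x, hx, y, hy, h1, h2, h3, h4, h5⟩⟩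
    · exact h
    · exact ⟨y, hy, x, hx, h2, h1, h4, h3, by rwa [SimpleGraph.dist_comm]⟩
  have hwalk : ∀ m i j (c : (Q m).Walk i j), ∀ x ∈ W, ∀ y ∈ W, lev x = m → lev y = m →
      col x = i → col y = j → G.dist x y ≤ D + c.length * (κ + D) := by
    intro m i j c
    induction c with
    | nil =>
      intro x hx y hy h1 h2 h3 h4
      simpa using hsame x hx y hy (h1.trans h2.symm) (h3.trans h4.symm)
    | cons hadj c ih =>
      intro x hx y hy h1 h2 h3 h4
      obtain ⟨x', hx', y', hy', h1', h2', h3', h4', h5'⟩ := hQadj _ _ _ hadj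
      have h6 := ih y' hy' y hy h2' h2 h4' h4
      have h7 := hsame x hx x' hx' (h1.trans h1'.symm) (h3.trans h3'.symm)
      have h8 := hG.dist_triangle (u := x) (v := x') (w := y)
      have h9 := hG.dist_triangle (u := x') (v := y') (w := y)
      rw [SimpleGraph.Walk.length_cons, add_mul, one_mul]
      omega
  set node : V → ℕ × Set (Fin n × Bool) :=
    fun x => (lev x, {j | (Q (lev x)).Reachable (col x) j}) with hnode
  have hnodedist : ∀ x ∈ W, ∀ y ∈ W, node x = node y → G.dist x y ≤ D + 2 * n * (κ + D) := by
    intro x hx y hy hxy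
    obtain ⟨h1, h2⟩ := Prod.mk.inj hxy
    have h3 : (Q (lev x)).Reachable (col x) (col y) := by
      change col y ∈ {j | (Q (lev x)).Reachable (col x) j}
      rw [h2]
      exact SimpleGraph.Reachable.refl _
    obtain ⟨c, hc⟩ := h3.exists_isPath
    have h4 := hc.length_lt
    rw [Fintype.card_prod, Fintype.card_fin, Fintype.card_bool, mul_comm] at h4
    refine (hwalk _ _ _ c x hx y hy rfl h1.symm rfl rfl).trans ?_
    gcongr
  have hnodeeq : ∀ x ∈ W, ∀ y ∈ W, lev x = lev y → G.dist x y ≤ κ → node x = node y := by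
    intro x hx y hy hl hxy
    have h1 : (Q (lev x)).Reachable (col x) (col y) := by
      by_cases h : col x = col y
      · rw [h]
      · exact SimpleGraph.Adj.reachable ⟨h, Or.inl ⟨x, hx, y, hy, rfl, hl.symm, rfl, rfl, hxy⟩⟩
    simp only [hnode, Prod.mk.injEq]
    refine ⟨hl, ?_⟩
    rw [← hl]
    ext j
    exact ⟨fun h => h1.symm.trans h, fun h => h1.trans h⟩
  -- Each cluster is collapsed to a representative chosen in `W`, so that the image stays in every
  -- convex set containing `W`.
  refine ⟨fun x => Function.invFunOn node W (node x), fun x hx => ⟨?_, ?_⟩, ?_⟩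
  · exact Function.invFunOn_mem ⟨x, hx, rfl⟩
  · exact hnodedist x hx _ (Function.invFunOn_mem ⟨x, hx, rfl⟩)
      (Function.invFunOn_eq ⟨x, hx, rfl⟩).symm
  · intro x hx y hy z hz hxy hyz hxz
    have h1 := hlevle x y hxy
    have h2 := hlevle y x (by rwa [SimpleGraph.dist_comm])
    have h3 := hlevle y z hyz
    have h4 := hlevle z y (by rwa [SimpleGraph.dist_comm])
    have h5 := hlevle x z hxz
    have h6 := hlevle z x (by rwa [SimpleGraph.dist_comm])
    -- Pairwise the levels differ by at most one, so the three levels take at most two values. Close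
    -- vertices of equal level share a cluster.
    have h7 : lev x = lev y ∨ lev y = lev z ∨ lev x = lev z := by omega
    rcases h7 with h | h | h
    · exact Or.inl (congrArg _ (hnodeeq x hx y hy h hxy))
    · exact Or.inr (Or.inl (congrArg _ (hnodeeq y hy z hz h hyz)))
    · exact Or.inr (Or.inr (congrArg _ (hnodeeq x hx z hz h hxz)))

/-- Filling of ordered cycles near `n` geodesics, provided that they vanish under maps which do not
map any three close vertices to distinct vertices. -/
lemma exists_word_filling (hG : G.Connected) (hδ : ThinTriangles G δ) (hκ : 4 * δ + 6 ≤ κ)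
    (n m L : ℕ) (hm : 1 ≤ m) : ∃ (r N : ℕ), ∀ (p q : Fin n → V) (W : Set V) (z : WordChain V),
      (∀ x ∈ W, ∃ j a, Between G (p j) (q j) a ∧ G.dist x a ≤ L) →
      z ∈ supported ℝ ℝ (smallWords G κ m W) → wordBoundary z = 0 →
      (∀ f : V → V, (∀ x ∈ W, ∀ y ∈ W, ∀ z ∈ W, G.dist x y ≤ κ → G.dist y z ≤ κ →
        G.dist x z ≤ κ → f x = f y ∨ f y = f z ∨ f x = f z) → wordMap f z = 0) →
      ∃ a : WordChain V, wordBoundary a = z ∧ l1 a ≤ N * l1 z ∧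
        a ∈ supported ℝ ℝ (smallWords G κ (m + 1) {x | ∃ y ∈ W, G.dist x y ≤ r}) ∧
        ∀ H, GeodesicallyConvex G H → W ⊆ H →
          a ∈ supported ℝ ℝ (smallWords G κ (m + 1) H) := by
  obtain ⟨K, hK⟩ := exists_collapse hG hδ κ n L
  -- A prism over a word of diameter `κ` has diameter at most `κ + 2 * K`.
  obtain ⟨θ, N, r, hθ⟩ := exists_localRetract hG hδ hκ (κ + 2 * K) (by omega) (m + 1)
  refine ⟨r, N * m, fun p q W z hW hz hz0 hzf => ?_⟩
  obtain ⟨f, hf, hf'⟩ := hK p q W hW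
  have hfz := hzf f hf'
  have hsupp : prism f z ∈ supported ℝ ℝ (smallWords G (κ + 2 * K) (m + 1) W) := by
    refine linearCombination_mem_supported (fun l hl => ?_) hz
    obtain ⟨h1, h2, h3⟩ := hl
    refine supported_mono ?_ (prismWord_mem_supported f l)
    rintro l' ⟨h1', h2'⟩
    have hnear : ∀ x ∈ l', x ∈ W ∧ ∃ y ∈ l, G.dist x y ≤ K := by
      intro x hx
      rcases h2' x hx with hx' | ⟨y, hy, rfl⟩
      · exact ⟨h3 x hx', x, hx', by simp⟩
      · exact ⟨(hf y (h3 y hy)).1, y, hy, by rw [SimpleGraph.dist_comm]; exact (hf y (h3 y hy)).2⟩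
    refine ⟨by omega, fun x hx y hy => ?_, fun x hx => (hnear x hx).1⟩
    obtain ⟨x', hx', hxx'⟩ := (hnear x hx).2
    obtain ⟨y', hy', hyy'⟩ := (hnear y hy).2
    have h4 := h2 x' hx' y' hy'
    have h5 := hG.dist_triangle (u := x) (v := x') (w := y)
    have h6 := hG.dist_triangle (u := x') (v := y') (w := y)
    rw [G.dist_comm (u := y') (v := y)] at h6
    omega
  have hθl : ∀ l ∈ smallWords G (κ + 2 * K) (m + 1) W, IsLocalRetract G κ N r θ l :=
    fun l hl => hθ l hl.1.le hl.2.1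
  have hbound : prism f z ∈ supported ℝ ℝ (smallWords G (κ + 2 * K) (m + 1) W) →
      wordBoundary (linearCombination ℝ θ (prism f z)) =
        linearCombination ℝ θ (wordBoundary (prism f z)) := by
    intro h
    rw [linearCombination_apply, Finsupp.sum, map_sum, wordBoundary,
      linearCombination_apply ℝ (prism f z), Finsupp.sum, map_sum]
    refine Finset.sum_congr rfl fun l hl => ?_
    rw [map_smul, map_smul]
    congr 1
    exact (hθl l (h hl)).boundary
  have hsub : ∀ S : Set (List V), (∀ l ∈ smallWords G (κ + 2 * K) (m + 1) W,
      θ l ∈ supported ℝ ℝ S) → -linearCombination ℝ θ (prism f z) ∈ supported ℝ ℝ S :=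
    fun S hS => Submodule.neg_mem _ (linearCombination_mem_supported hS hsupp)
  -- As `f` kills `z`, the boundary of the prism is `-z`, and `θ` is a chain map that fixes the
  -- small words of `z`.
  refine ⟨-linearCombination ℝ θ (prism f z), ?_, ?_, ?_, ?_⟩
  · have h1 := wordBoundary_prism f z
    rw [hz0, map_zero, add_zero, hfz, zero_sub] at h1
    rw [map_neg, hbound hsupp, h1, map_neg, neg_neg]
    refine (linearCombination_congr_on (ψ := fun l => single l 1) hz fun l hl => ?_).trans
      (linearCombination_single_one z)
    refine (hθ l (by have := hl.1; omega) fun x hx y hy => ?_).eq_single hl.2.1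
    exact (hl.2.1 x hx y hy).trans (by omega)
  · rw [l1_neg]
    refine (l1_linearCombination_le fun l hl => (hθl l (hsupp hl)).l1_le).trans ?_
    rw [Nat.cast_mul, mul_assoc]
    gcongr
    refine l1_linearCombination_le fun l hl => ?_
    have := l1_prismWord_le f l
    rwa [(hz hl).1] at this
  · refine hsub _ fun l hl => ?_
    obtain ⟨B, -, hB, -, hB'⟩ := (hθl l hl).exists_finset
    rw [hl.1] at hB
    obtain ⟨x, hx⟩ : ∃ x, x ∈ l := List.exists_mem_of_length_pos (by have := hl.1; omega)
    have hBr : (B : Set V) ⊆ {x | ∃ y ∈ W, G.dist x y ≤ r} :=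
      fun b hb => ⟨x, hl.2.2 x hx, hB' b hb x hx⟩
    exact supported_mono (smallWords_mono hBr) hB
  · intro H hH hWH
    refine hsub _ fun l hl => ?_
    obtain ⟨B, -, hB, hB', -⟩ := (hθl l hl).exists_finset
    rw [hl.1] at hB
    exact supported_mono (smallWords_mono (hB' H hH fun x hx => hWH (hl.2.2 x hx))) hB

end Collapse

/-! ### Connectedness of the cusped graph and convexity of deep horoballs. -/

section CuspedGraphGeometry

variable {Γ : Type u} {I : Type v}

lemma CuspVertex.height_mk (g : Γ) (i : I) (m : ℕ) : (CuspVertex.mk g i m).height = m := by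
  cases m <;> rfl

/-- Raising the vertices of a horoball to height at least `n + 1`. -/
def raise (n : ℕ) : CuspVertex Γ I → CuspVertex Γ I
  | .base g => .base g
  | .cusp g i m => .cusp g i (max m n)

lemma raise_eq_self {n : ℕ} {x : CuspVertex Γ I} (h : n < x.height) : raise n x = x := by
  cases x with
  | base g => rfl
  | cusp g i m =>
    simp only [CuspVertex.height] at h
    rw [raise, max_eq_left (by omega)]

variable [Group Γ] {P : I → Subgroup Γ} {S : Set Γ}

lemma reachable_mulCayley {T : Set Γ} {g h : Γ} (hgh : g⁻¹ * h ∈ Subgroup.closure T) :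
    (SimpleGraph.mulCayley T).Reachable g h := by
  have key : ∀ x ∈ Subgroup.closure T, ∀ g : Γ, (SimpleGraph.mulCayley T).Reachable g (g * x) := by
    intro x hx
    induction hx using Subgroup.closure_induction with
    | mem x hx =>
      intro g
      by_cases h : g = g * x
      · rw [← h]
      · refine SimpleGraph.Adj.reachable ?_
        rw [SimpleGraph.mulCayley_adj]
        exact ⟨h, Or.inl (by simpa using hx)⟩
    | one => simp
    | mul x y _ _ hx hy =>
      intro g
      rw [← mul_assoc]
      exact (hx g).trans (hy (g * x))
    | inv x _ hx =>
      intro g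
      simpa using (hx (g * x⁻¹)).symm
  simpa using key _ hgh g

lemma mem_closure_of_reachable_mulCayley {T : Set Γ} {g h : Γ}
    (hgh : (SimpleGraph.mulCayley T).Reachable g h) : g⁻¹ * h ∈ Subgroup.closure T := by
  obtain ⟨p⟩ := hgh
  induction p with
  | nil => simp
  | cons hadj p ih =>
    rename_i a b c
    rw [SimpleGraph.mulCayley_adj] at hadj
    have h1 : a⁻¹ * b ∈ Subgroup.closure T := by
      rcases hadj.2 with h | h
      · exact Subgroup.subset_closure h
      · simpa using Subgroup.inv_mem _ (Subgroup.subset_closure h)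
    simpa [mul_assoc] using Subgroup.mul_mem _ h1 ih

lemma cuspedGraph_adj_vertical (P : I → Subgroup Γ) (S : Set Γ) (g : Γ) (i : I) (m : ℕ) :
    (cuspedGraph P S).Adj (.mk g i m) (.mk g i (m + 1)) :=
  Or.inr ⟨i, g, g, m, m + 1, rfl, rfl, Or.inl ⟨rfl, Or.inl rfl⟩⟩

lemma cuspedGraph_exists_vertical_walk (P : I → Subgroup Γ) (S : Set Γ) (g : Γ) (i : I) (m t : ℕ) :
    ∃ p : (cuspedGraph P S).Walk (.mk g i m) (.mk g i (m + t)), p.length = t := by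
  induction t with
  | zero => exact ⟨.nil, rfl⟩
  | succ t ih =>
    obtain ⟨p, hp⟩ := ih
    exact ⟨p.concat (cuspedGraph_adj_vertical P S g i (m + t)), by simp [hp]⟩

lemma cuspedGraph_connected (hS : Subgroup.closure S = ⊤) :
    (cuspedGraph P S).Connected := by
  have hbase : ∀ g : Γ, (cuspedGraph P S).Reachable (.base 1) (.base g) := by
    intro g
    have h1 : (SimpleGraph.mulCayley S).Reachable 1 g := reachable_mulCayley (by simp [hS])
    let φ : SimpleGraph.mulCayley S →g cuspedGraph P S :=
      ⟨CuspVertex.base, fun {a b} h => Or.inl ⟨a, b, rfl, rfl, h⟩⟩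
    exact h1.map φ
  have hall : ∀ x : CuspVertex Γ I, (cuspedGraph P S).Reachable (.base 1) x := by
    rintro (g | ⟨g, i, n⟩)
    · exact hbase g
    · obtain ⟨p, -⟩ := cuspedGraph_exists_vertical_walk P S g i 0 (n + 1)
      rw [zero_add] at p
      exact (hbase g).trans ⟨p⟩
  have : Nonempty (CuspVertex Γ I) := ⟨.base 1⟩
  exact SimpleGraph.Connected.mk fun x y => (hall x).symm.trans (hall y)

lemma cuspedGraph_height_le_of_adj {x y : CuspVertex Γ I} (h : (cuspedGraph P S).Adj x y) :
    x.height ≤ y.height + 1 := by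
  rcases h with ⟨g, h, rfl, rfl, -⟩ | ⟨i, g, h, m, n, rfl, rfl, h1⟩
  · simp [CuspVertex.height]
  · rw [CuspVertex.height_mk, CuspVertex.height_mk]
    rcases h1 with ⟨-, h1⟩ | ⟨h1, -⟩ <;> simp only at h1 <;> omega

lemma cuspedGraph_height_le (hX : (cuspedGraph P S).Connected) (x y : CuspVertex Γ I) :
    x.height ≤ y.height + (cuspedGraph P S).dist x y := by
  obtain ⟨p, hp⟩ := hX.exists_walk_length_eq_dist x y
  rw [← hp]
  clear hp
  induction p with
  | nil => simp
  | cons h p ih =>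
    have := cuspedGraph_height_le_of_adj h
    rw [SimpleGraph.Walk.length_cons]
    omega

lemma cuspedGraph_adj_cusp {g h : Γ} {i j : I} {m n : ℕ}
    (hadj : (cuspedGraph P S).Adj (.cusp g i m) (.cusp h j n)) :
    i = j ∧
      (horoballGraph (SimpleGraph.mulCayley (S ∩ (P i : Set Γ)))).Adj (g, m + 1) (h, n + 1) := by
  rcases hadj with ⟨_, _, h1, -⟩ | ⟨i', g', h', m', n', h1, h2, h3⟩
  · cases h1
  · cases m' <;> cases n' <;> simp only [CuspVertex.mk] at h1 h2 <;> cases h1 <;> cases h2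
    exact ⟨rfl, h3⟩

lemma raise_eq_or_adj {n : ℕ} {x y : CuspVertex Γ I} (hx : 0 < x.height) (hy : 0 < y.height)
    (h : (cuspedGraph P S).Adj x y) :
    raise n x = raise n y ∨ (cuspedGraph P S).Adj (raise n x) (raise n y) := by
  cases x with
  | base g => simp [CuspVertex.height] at hx
  | cusp g i m =>
  cases y with
  | base g => simp [CuspVertex.height] at hy
  | cusp g' j k =>
    obtain ⟨rfl, ⟨h1, h2⟩ | ⟨h1, h2, h3⟩⟩ := cuspedGraph_adj_cusp h
    · simp only at h1 h2
      subst h1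
      simp only [raise]
      by_cases hm : n ≤ m ∧ n ≤ k
      · right
        rw [max_eq_left hm.1, max_eq_left hm.2]
        exact h
      · left
        congr 1
        omega
    · simp only at h1 h2 h3
      obtain rfl : m = k := by omega
      right
      refine Or.inr ⟨i, g, g', max m n + 1, max m n + 1, rfl, rfl, Or.inr ⟨rfl, h2, h3.trans ?_⟩⟩
      exact pow_le_pow_right₀ (by norm_num) (by simp)

/-- An edge crossing from height `n` to `n + 1` is vertical, so raising collapses it. This is the
source of the strict gain in `dist_raise_le`. -/
lemma raise_eq_of_adj {n : ℕ} {x y : CuspVertex Γ I} (hx : 0 < x.height) (hxn : x.height ≤ n)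
    (hyn : n < y.height) (h : (cuspedGraph P S).Adj x y) : raise n x = raise n y := by
  cases x with
  | base g => simp [CuspVertex.height] at hx
  | cusp g i m =>
  cases y with
  | base g => simp [CuspVertex.height] at hyn
  | cusp h j k =>
    simp only [CuspVertex.height] at hxn hyn
    obtain ⟨rfl, ⟨h1, h2⟩ | ⟨h1, h2, h3⟩⟩ := cuspedGraph_adj_cusp h
    · simp only at h1 h2
      subst h1
      simp only [raise]
      congr 1
      omega
    · simp only at h1
      omega

lemma dist_raise_le (hX : (cuspedGraph P S).Connected) {n : ℕ} {x y : CuspVertex Γ I}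
    (p : (cuspedGraph P S).Walk x y) (hp : ∀ a ∈ p.support, 0 < a.height) (hy : n < y.height) :
    (cuspedGraph P S).dist (raise n x) y ≤ p.length ∧
      (x.height ≤ n → (cuspedGraph P S).dist (raise n x) y + 1 ≤ p.length) := by
  induction p with
  | nil => simp [raise_eq_self hy, hy]
  | cons h p ih =>
    rename_i x' y' z'
    obtain ⟨h1, h2⟩ := ih (fun a ha => hp a (by simp [ha])) hy
    have hx0 : 0 < x'.height := hp x' (by simp)
    have hy0 : 0 < y'.height := hp y' (by simp)
    have h3 := hX.dist_triangle (u := raise n x') (v := raise n y') (w := z')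
    have h4 : (cuspedGraph P S).dist (raise n x') (raise n y') ≤ 1 := by
      rcases raise_eq_or_adj (n := n) hx0 hy0 h with h | h
      · simp [h]
      · exact (SimpleGraph.dist_eq_one_iff_adj.2 h).le
    rw [SimpleGraph.Walk.length_cons]
    refine ⟨by omega, fun hxn => ?_⟩
    by_cases hyn : y'.height ≤ n
    · have := h2 hyn
      omega
    · rw [raise_eq_of_adj hx0 hxn (not_le.1 hyn) h]
      omega

/-- Different horoballs meet only at height zero, and horizontal edges stay in one component of the
Cayley graph, which is a coset. -/
lemma mem_horoballVertices_of_walk {g : Γ} {i : I} {x y : CuspVertex Γ I}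
    (p : (cuspedGraph P S).Walk x y) (hp : ∀ a ∈ p.support, 0 < a.height)
    (hS : ∀ i, Subgroup.closure (S ∩ (P i : Set Γ)) = P i) (hx : x ∈ horoballVertices P 0 g i) :
    y ∈ horoballVertices P 0 g i := by
  induction p with
  | nil => exact hx
  | cons h p ih =>
    rename_i x' y' z'
    refine ih (fun a ha => hp a (by simp [ha])) ?_
    have hx0 : 0 < x'.height := hp x' (by simp)
    have hy0 : 0 < y'.height := hp y' (by simp)
    obtain ⟨g', m, hg', -, rfl⟩ := hx
    cases m with
    | zero => simp [CuspVertex.mk, CuspVertex.height] at hx0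
    | succ m =>
    cases y' with
    | base g => simp [CuspVertex.height] at hy0
    | cusp h' j k =>
      obtain ⟨rfl, h1⟩ := cuspedGraph_adj_cusp h
      refine ⟨h', k + 1, ?_, Nat.zero_le _, rfl⟩
      rcases h1 with ⟨h1, -⟩ | ⟨-, -, h1⟩
      · simp only at h1
        rwa [← h1]
      · have h2 : (SimpleGraph.mulCayley (S ∩ (P i : Set Γ))).Reachable g' h' := by
          refine SimpleGraph.reachable_of_edist_ne_top (ne_top_of_le_ne_top ?_ h1)
          exact ENat.natCast_ne_top (2 ^ (m + 1))
        have h3 := mem_closure_of_reachable_mulCayley h2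
        rw [hS] at h3
        simpa [mul_assoc] using Subgroup.mul_mem _ hg' h3

/-- Two vertices of a horoball have a common apex far up in the horoball, which can be reached from
each of them by an almost vertical path. -/
lemma exists_apex (hS : ∀ i, Subgroup.closure (S ∩ (P i : Set Γ)) = P i) {g h h' : Γ} {i : I}
    (hh : g⁻¹ * h ∈ P i) (hh' : g⁻¹ * h' ∈ P i) (m m' : ℕ) :
    ∃ T, m ≤ T ∧ m' ≤ T ∧
      (cuspedGraph P S).dist (.mk h i m) (.mk h' i T) ≤ T - m + 1 ∧
      (cuspedGraph P S).dist (.mk h' i m') (.mk h' i T) ≤ T - m' + 1 := by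
  have h1 : (SimpleGraph.mulCayley (S ∩ (P i : Set Γ))).Reachable h h' := by
    apply reachable_mulCayley
    rw [hS]
    simpa [mul_assoc] using Subgroup.mul_mem _ (Subgroup.inv_mem _ hh) hh'
  set D := (SimpleGraph.mulCayley (S ∩ (P i : Set Γ))).dist h h' with hD
  have hvert : ∀ (h : Γ) (m T : ℕ), m ≤ T →
      ∃ p : (cuspedGraph P S).Walk (.mk h i m) (.mk h i T), p.length = T - m := by
    intro h m T hT
    obtain ⟨p, hp⟩ := cuspedGraph_exists_vertical_walk P S h i m (T - m)
    have hmT : m + (T - m) = T := by omega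
    exact ⟨p.copy rfl (by rw [hmT]), by simp [hp]⟩
  -- At this height `D ≤ 2 ^ T`, so a single horizontal edge joins the two vertical rays.
  refine ⟨m + m' + D, by omega, by omega, ?_, ?_⟩
  · obtain ⟨p, hp⟩ := hvert h m (m + m' + D) (by omega)
    by_cases hhh : h = h'
    · rw [← hhh]
      exact (SimpleGraph.dist_le p).trans (by omega)
    · have hadj : (cuspedGraph P S).Adj (.mk h i (m + m' + D)) (.mk h' i (m + m' + D)) := by
        refine Or.inr ⟨i, h, h', _, _, rfl, rfl, Or.inr ⟨rfl, hhh, ?_⟩⟩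
        rw [← h1.coe_dist_eq_edist, ← hD]
        simp only
        have h2 : D ≤ 2 ^ (m + m' + D) := D.lt_two_pow_self.le.trans
          (Nat.pow_le_pow_right (by norm_num) (by omega))
        exact_mod_cast h2
      refine (SimpleGraph.dist_le (p.concat hadj)).trans ?_
      rw [SimpleGraph.Walk.length_concat, hp]
  · obtain ⟨p, hp⟩ := hvert h' m' (m + m' + D) (by omega)
    exact (SimpleGraph.dist_le p).trans (by omega)

/-- The `C`-horoballs with `C > δ` are convex. -/
lemma geodesicallyConvex_horoballVertices (hX : (cuspedGraph P S).Connected)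
    (hS : ∀ i, Subgroup.closure (S ∩ (P i : Set Γ)) = P i) {δ C : ℕ}
    (hδ : ThinTriangles (cuspedGraph P S) δ) (hC : δ < C) (g : Γ) (i : I) :
    GeodesicallyConvex (cuspedGraph P S) (horoballVertices P C g i) := by
  rintro x ⟨h, m, hh, hm, hx⟩ y ⟨h', m', hh', hm', hy⟩ a ha
  -- In the triangle with an apex, the two sides towards the apex stay at height at least `C`: a
  -- descent below `C` would lengthen the vertical path by at least two, while only one is allowed.
  -- Slimness then keeps `a` at height at least `C - δ > 0`.
  have hpos : ∀ a, Between (cuspedGraph P S) x y a → 0 < a.height := by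
    intro a ha
    obtain ⟨T, hT, hT', hd, hd'⟩ := exists_apex (S := S) hS hh hh' m m'
    rw [← hx] at hd
    rw [← hy] at hd'
    have hside : ∀ (z : CuspVertex Γ I) (k : ℕ), z.height = k → C ≤ k → k ≤ T →
        (cuspedGraph P S).dist z (.mk h' i T) ≤ T - k + 1 →
        ∀ b, Between (cuspedGraph P S) z (.mk h' i T) b → C ≤ b.height := by
      intro z k hz hk hkT hzd b hb
      have h1 := cuspedGraph_height_le hX z b
      have h2 := cuspedGraph_height_le hX (.mk h' i T) b
      rw [CuspVertex.height_mk, SimpleGraph.dist_comm] at h2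
      unfold Between at hb
      omega
    obtain ⟨b, hb, hab⟩ := hδ x y (.mk h' i T) a ha
    have h1 : C ≤ b.height := by
      rcases hb with hb | hb
      · exact hside y m' (by rw [hy, CuspVertex.height_mk]) hm' hT' hd' b hb
      · exact hside x m (by rw [hx, CuspVertex.height_mk]) hm hT hd b hb
    have h2 := cuspedGraph_height_le hX b a
    rw [SimpleGraph.dist_comm] at h2
    omega
  have hwalk : ∀ z, z = x ∨ z = y → ∀ p : (cuspedGraph P S).Walk a z,
      p.length = (cuspedGraph P S).dist a z → ∀ b ∈ p.support, 0 < b.height := by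
    intro z hz p hp b hb
    have hb' := between_of_mem_support hX hp hb
    refine hpos b ?_
    have h1 := hX.dist_triangle (u := x) (v := b) (w := y)
    have h2 := hX.dist_triangle (u := x) (v := a) (w := b)
    have h3 := hX.dist_triangle (u := b) (v := a) (w := y)
    have h4 := (cuspedGraph P S).dist_comm (u := a) (v := x)
    have h5 := (cuspedGraph P S).dist_comm (u := b) (v := x)
    have h6 := (cuspedGraph P S).dist_comm (u := a) (v := b)
    unfold Between at *
    rcases hz with rfl | rfl <;> omega
  obtain ⟨p, hp⟩ := hX.exists_walk_length_eq_dist a x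
  obtain ⟨q, hq⟩ := hX.exists_walk_length_eq_dist a y
  have hxC : C - 1 < x.height := by
    rw [hx, CuspVertex.height_mk]
    omega
  have hyC : C - 1 < y.height := by
    rw [hy, CuspVertex.height_mk]
    omega
  have h1 := dist_raise_le hX p (hwalk x (Or.inl rfl) p hp) hxC
  have h2 := dist_raise_le hX q (hwalk y (Or.inr rfl) q hq) hyC
  have h3 := hX.dist_triangle (u := x) (v := raise (C - 1) a) (w := y)
  have h4 := (cuspedGraph P S).dist_comm (u := x) (v := raise (C - 1) a)
  have h5 := (cuspedGraph P S).dist_comm (u := x) (v := a)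
  -- `raise (C - 1)` lifts to height `C`. If `a` were lower, both halves of the geodesic through `a`
  -- would become strictly shorter.
  have haC : C ≤ a.height := by
    by_contra hcon
    have h6 := h1.2 (by omega)
    have h7 := h2.2 (by omega)
    unfold Between at ha
    omega
  have h6 : a ∈ horoballVertices P 0 g i := by
    refine mem_horoballVertices_of_walk p.reverse (fun b hb => ?_) hS
      ⟨h, m, hh, Nat.zero_le _, hx⟩
    exact hwalk x (Or.inl rfl) p hp b (by simpa using hb)
  obtain ⟨h'', m'', hh'', -, rfl⟩ := h6
  rw [CuspVertex.height_mk] at haC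
  exact ⟨h'', m'', hh'', haC, rfl⟩

end CuspedGraphGeometry

/-! ### Passage between ordered and oriented chains. -/

section Oriented

variable {V : Type u}

/-- The signed sum over all reorderings of the tuples. -/
def alternation (n : ℕ) : ((Fin n → V) →₀ ℝ) →ₗ[ℝ] ((Fin n → V) →₀ ℝ) :=
  ∑ σ : Equiv.Perm (Fin n), ((Equiv.Perm.sign σ : ℤ) : ℝ) • lmapDomain ℝ ℝ fun t => t ∘ σ

/-- The words of length `n`, as tuples. -/
def wordsToTuples (n : ℕ) : WordChain V →ₗ[ℝ] ((Fin n → V) →₀ ℝ) :=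
  lcomapDomain (List.ofFn (n := n)) List.ofFn_injective

/-- The tuples, as words. -/
def tuplesToWords (n : ℕ) : ((Fin n → V) →₀ ℝ) →ₗ[ℝ] WordChain V :=
  lmapDomain ℝ ℝ List.ofFn

@[simp] lemma wordsToTuples_tuplesToWords {n : ℕ} (c : (Fin n → V) →₀ ℝ) :
    wordsToTuples n (tuplesToWords n c) = c := by
  ext t
  exact Finsupp.mapDomain_apply List.ofFn_injective c t

lemma tuplesToWords_wordsToTuples {n : ℕ} {c : WordChain V}
    (hc : c ∈ supported ℝ ℝ {l : List V | l.length = n}) :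
    tuplesToWords n (wordsToTuples n c) = c := by
  refine Finsupp.mapDomain_comapDomain _ List.ofFn_injective c fun l hl => ?_
  obtain rfl : l.length = n := hc hl
  exact ⟨l.get, List.ofFn_get l⟩

/-- The ordered boundary operator on tuples. -/
def tupleBoundary (n : ℕ) : ((Fin (n + 1) → V) →₀ ℝ) →ₗ[ℝ] ((Fin n → V) →₀ ℝ) :=
  ∑ i : Fin (n + 1), (-1 : ℝ) ^ (i : ℕ) • lmapDomain ℝ ℝ fun t => t ∘ i.succAbove

lemma faceSum_ofFn {n : ℕ} (t : Fin (n + 1) → V) :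
    faceSum (List.ofFn t) =
      ∑ i : Fin (n + 1), (-1 : ℝ) ^ (i : ℕ) • single (List.ofFn (t ∘ i.succAbove)) (1 : ℝ) := by
  induction n with
  | zero => simp [faceSum]
  | succ n ih =>
    rw [List.ofFn_succ, faceSum, ih, map_sum, Fin.sum_univ_succ (n := n + 1), sub_eq_add_neg,
      ← Finset.sum_neg_distrib]
    congr 1
    · simp [Function.comp_def]
    · refine Finset.sum_congr rfl fun i _ => ?_
      rw [map_smul, prepend_single, Fin.val_succ, pow_succ, mul_neg_one, neg_smul]
      congr 3
      rw [List.ofFn_succ]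
      simp [Function.comp_def]

lemma wordBoundary_tuplesToWords {n : ℕ} (c : (Fin (n + 1) → V) →₀ ℝ) :
    wordBoundary (tuplesToWords (n + 1) c) = tuplesToWords n (tupleBoundary n c) := by
  suffices h : wordBoundary ∘ₗ tuplesToWords (V := V) (n + 1) =
      tuplesToWords n ∘ₗ tupleBoundary n from LinearMap.congr_fun h c
  refine Finsupp.lhom_ext' fun t => LinearMap.ext_ring ?_
  have h := faceSum_ofFn t
  simp only [LinearMap.comp_apply, lsingle_apply, tuplesToWords, tupleBoundary,
    LinearMap.sum_apply, LinearMap.smul_apply, map_sum, map_smul, lmapDomain_apply,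
    mapDomain_single, wordBoundary_single, h]

lemma comp_cycleRange_symm_succ {n : ℕ} (t : Fin (n + 1) → V) (i : Fin (n + 1)) :
    Fin.tail (t ∘ i.cycleRange.symm) = t ∘ i.succAbove := by
  ext j
  simp [Fin.tail, Fin.cycleRange_symm_succ]

/-- A permutation of `Fin (n + 1)` as a permutation of `Fin n` followed by a cycle. -/
lemma exists_perm_decomposition {n : ℕ} (p : Fin (n + 1) × Equiv.Perm (Fin n)) :
    ∃ σ : Equiv.Perm (Fin (n + 1)), σ 0 = p.1 ∧ (∀ j, σ j.succ = p.1.succAbove (p.2 j)) ∧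
      ((Equiv.Perm.sign σ : ℤ) : ℝ) = (-1) ^ (p.1 : ℕ) * ((Equiv.Perm.sign p.2 : ℤ) : ℝ) := by
  refine ⟨p.1.cycleRange.symm * Equiv.Perm.decomposeFin.symm (0, p.2), ?_, ?_, ?_⟩
  · simp [Fin.cycleRange_symm_zero]
  · intro j
    simp [Fin.cycleRange_symm_succ]
  · simp [Fin.sign_cycleRange, Equiv.Perm.decomposeFin.symm_sign]

/-- A permutation is determined by the image `i` of `0` and the induced permutation of the rest.
This is the reindexing that turns deletion of the first entry into the alternating sum over faces.
-/
lemma sum_perm_succ {M : Type*} [AddCommMonoid M] {n : ℕ}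
    (φ : Equiv.Perm (Fin (n + 1)) → M) (ψ : Fin (n + 1) → Equiv.Perm (Fin n) → M)
    (h : ∀ (σ : Equiv.Perm (Fin (n + 1))) (i : Fin (n + 1)) (τ : Equiv.Perm (Fin n)),
      σ 0 = i → (∀ j : Fin n, σ j.succ = i.succAbove (τ j)) →
      ((Equiv.Perm.sign σ : ℤ) : ℝ) = (-1) ^ (i : ℕ) * ((Equiv.Perm.sign τ : ℤ) : ℝ) →
      φ σ = ψ i τ) : ∑ σ, φ σ = ∑ i, ∑ τ, ψ i τ := by
  rw [← Fintype.sum_prod_type']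
  choose σ h1 h2 h3 using exists_perm_decomposition (n := n)
  have hinj : Function.Injective σ := by
    intro p q hpq
    have h4 : p.1 = q.1 := by rw [← h1 p, ← h1 q, hpq]
    refine Prod.ext h4 (Equiv.ext fun j => ?_)
    have h5 := h2 p j
    rw [hpq, h2 q j, h4] at h5
    exact (Fin.succAbove_right_injective h5).symm
  have hbij : Function.Bijective σ := by
    rw [Fintype.bijective_iff_injective_and_card]
    exact ⟨hinj, by simp [Fintype.card_perm, Nat.factorial_succ]⟩
  exact (Fintype.sum_bijective σ hbij _ _ fun p =>
    (h (σ p) p.1 p.2 (h1 p) (h2 p) (h3 p)).symm).symm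

lemma boundary_alternation {n : ℕ} (c : (Fin (n + 1) → V) →₀ ℝ) :
    boundary n (alternation (n + 1) c) = alternation n (tupleBoundary n c) := by
  suffices h : boundary n ∘ₗ alternation (V := V) (n + 1) =
      alternation n ∘ₗ tupleBoundary n from LinearMap.congr_fun h c
  refine Finsupp.lhom_ext' fun t => LinearMap.ext_ring ?_
  simp only [LinearMap.comp_apply, lsingle_apply, alternation, tupleBoundary, boundary,
    LinearMap.sum_apply, LinearMap.smul_apply, map_sum, map_smul, lmapDomain_apply,
    mapDomain_single, Finset.smul_sum]
  refine sum_perm_succ _ _ fun σ i τ h1 h2 h3 => ?_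
  have h4 : Fin.tail (t ∘ σ) = (t ∘ i.succAbove) ∘ τ := by
    ext j
    simp [Fin.tail, h2]
  rw [h3, h4, smul_smul]

lemma lmapDomain_comp_perm_apply {n : ℕ} (c : (Fin n → V) →₀ ℝ) (σ : Equiv.Perm (Fin n))
    (t : Fin n → V) : lmapDomain ℝ ℝ (fun t => t ∘ σ) c t = c (t ∘ σ.symm) := by
  have h : Function.Injective fun t : Fin n → V => t ∘ σ := fun a b hab => by
    simpa [Function.comp_assoc] using congrArg (fun t => t ∘ σ.symm) hab
  have h' := Finsupp.mapDomain_apply h c (t ∘ σ.symm)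
  simpa [Function.comp_assoc] using h'

lemma alternation_apply {n : ℕ} (c : (Fin n → V) →₀ ℝ) (t : Fin n → V) :
    alternation n c t =
      ∑ σ : Equiv.Perm (Fin n), ((Equiv.Perm.sign σ : ℤ) : ℝ) * c (t ∘ σ.symm) := by
  simp only [alternation, LinearMap.sum_apply, LinearMap.smul_apply, Finsupp.finsetSum_apply,
    Finsupp.smul_apply, lmapDomain_comp_perm_apply, smul_eq_mul]

lemma sign_mul_sign {n : ℕ} (σ : Equiv.Perm (Fin n)) :
    ((Equiv.Perm.sign σ : ℤ) : ℝ) * ((Equiv.Perm.sign σ : ℤ) : ℝ) = 1 := by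
  rcases Int.units_eq_one_or (Equiv.Perm.sign σ) with h | h <;> simp [h]

/-- Alternating functions on tuples. -/
def IsAlternating {n : ℕ} (c : (Fin n → V) →₀ ℝ) : Prop :=
  ∀ (t : Fin n → V) (σ : Equiv.Perm (Fin n)),
    c (t ∘ σ) = ((Equiv.Perm.sign σ : ℤ) : ℝ) * c t

lemma isAlternating_alternation {n : ℕ} (c : (Fin n → V) →₀ ℝ) :
    IsAlternating (alternation n c) := by
  intro t σ
  rw [alternation_apply, alternation_apply, Finset.mul_sum]
  refine Fintype.sum_equiv (Equiv.mulRight σ⁻¹) _ _ fun τ => ?_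
  have h := sign_mul_sign σ
  have h1 : (t ∘ ⇑(τ * σ⁻¹).symm) = (t ∘ σ) ∘ τ.symm := by
    ext j
    simp [← Equiv.Perm.inv_def]
  simp only [Equiv.coe_mulRight]
  rw [h1, Equiv.Perm.sign_mul, Equiv.Perm.sign_inv]
  push_cast
  linear_combination (-((Equiv.Perm.sign τ : ℤ) : ℝ) * c ((t ∘ σ) ∘ τ.symm)) * h

lemma alternation_of_alternating {n : ℕ} {c : (Fin n → V) →₀ ℝ} (hc : IsAlternating c) :
    alternation n c = (n.factorial : ℝ) • c := by
  ext t
  rw [alternation_apply, Finsupp.smul_apply, smul_eq_mul]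
  have h : ∀ σ : Equiv.Perm (Fin n), ((Equiv.Perm.sign σ : ℤ) : ℝ) * c (t ∘ σ.symm) = c t := by
    intro σ
    rw [hc t σ.symm, Equiv.Perm.sign_symm, ← mul_assoc, sign_mul_sign, one_mul]
  rw [Finset.sum_congr rfl fun σ _ => h σ]
  simp [Fintype.card_perm]

lemma IsAlternating.lmapDomain_comp_perm {n : ℕ} {c : (Fin n → V) →₀ ℝ} (hc : IsAlternating c)
    (σ : Equiv.Perm (Fin n)) :
    lmapDomain ℝ ℝ (fun t => t ∘ σ) c = ((Equiv.Perm.sign σ : ℤ) : ℝ) • c := by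
  ext t
  rw [lmapDomain_comp_perm_apply, hc t σ.symm, Equiv.Perm.sign_symm, Finsupp.smul_apply,
    smul_eq_mul]

lemma isAlternating_lmapDomain {n : ℕ} {c : (Fin n → V) →₀ ℝ} (hc : IsAlternating c)
    (f : V → V) : IsAlternating (lmapDomain ℝ ℝ (fun t : Fin n → V => f ∘ t) c) := by
  intro t σ
  have h1 := hc.lmapDomain_comp_perm σ.symm
  have h2 := congrArg (lmapDomain ℝ ℝ fun t : Fin n → V => f ∘ t) h1
  have h3 : lmapDomain ℝ ℝ (fun t : Fin n → V => f ∘ t)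
      (lmapDomain ℝ ℝ (fun t => t ∘ σ.symm) c) = lmapDomain ℝ ℝ (fun t => t ∘ σ.symm)
      (lmapDomain ℝ ℝ (fun t : Fin n → V => f ∘ t) c) := by
    simp only [lmapDomain_apply, ← Finsupp.mapDomain_comp]
    rfl
  rw [h3, map_smul, Equiv.Perm.sign_symm] at h2
  have h4 := DFunLike.congr_fun h2 t
  rwa [lmapDomain_comp_perm_apply, Equiv.symm_symm, Finsupp.smul_apply, smul_eq_mul] at h4

lemma IsAlternating.apply_eq_zero {n : ℕ} {c : (Fin n → V) →₀ ℝ} (hc : IsAlternating c)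
    {t : Fin n → V} {i j : Fin n} (hij : i ≠ j) (h : t i = t j) : c t = 0 := by
  have h1 := hc t (Equiv.swap i j)
  have h2 : t ∘ Equiv.swap i j = t := by
    ext l
    by_cases hi : l = i
    · simp [hi, h]
    · by_cases hj : l = j
      · simp [hj, h]
      · simp [Equiv.swap_apply_of_ne_of_ne hi hj]
  rw [h2, Equiv.Perm.sign_swap hij] at h1
  push_cast at h1
  linarith

/-- For an alternating chain every single face term vanishes: deleting entry `i` means cycling it to
the front, which only changes the sign of `c`, and applying `boundary`. -/
lemma tupleBoundary_of_alternating {n : ℕ} {c : (Fin (n + 1) → V) →₀ ℝ} (hc : IsAlternating c)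
    (h : boundary n c = 0) : tupleBoundary n c = 0 := by
  rw [tupleBoundary, LinearMap.sum_apply]
  refine Finset.sum_eq_zero fun i _ => ?_
  have h1 : (fun t : Fin (n + 1) → V => t ∘ i.succAbove) =
      Fin.tail ∘ fun t : Fin (n + 1) → V => t ∘ i.cycleRange.symm := by
    ext t : 1
    exact (comp_cycleRange_symm_succ t i).symm
  have h2 : lmapDomain ℝ ℝ (fun t : Fin (n + 1) → V => t ∘ i.succAbove) c =
      boundary n (lmapDomain ℝ ℝ (fun t : Fin (n + 1) → V => t ∘ i.cycleRange.symm) c) := by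
    rw [h1]
    exact Finsupp.mapDomain_comp
  rw [LinearMap.smul_apply, h2, hc.lmapDomain_comp_perm, map_smul, h, smul_zero, smul_zero]

lemma l1_alternation_le {n : ℕ} (c : (Fin n → V) →₀ ℝ) :
    l1 (alternation n c) ≤ n.factorial * l1 c := by
  rw [alternation, LinearMap.sum_apply]
  refine (l1_sum_le _ _).trans ?_
  have h : ∀ σ : Equiv.Perm (Fin n), l1 ((((Equiv.Perm.sign σ : ℤ) : ℝ) •
      lmapDomain ℝ ℝ fun t : Fin n → V => t ∘ σ) c) ≤ l1 c := by
    intro σ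
    rw [LinearMap.smul_apply, l1_smul]
    have : |((Equiv.Perm.sign σ : ℤ) : ℝ)| = 1 := by
      rcases Int.units_eq_one_or (Equiv.Perm.sign σ) with h | h <;> simp [h]
    rw [this, one_mul]
    exact l1_lmapDomain_le _ _
  refine (Finset.sum_le_sum fun σ _ => h σ).trans ?_
  simp [Fintype.card_perm]

lemma l1_wordsToTuples_le {n : ℕ} (c : WordChain V) : l1 (wordsToTuples n c) ≤ l1 c := by
  have h : ∀ t : Fin n → V, wordsToTuples n c t = c (List.ofFn t) := fun t => rfl
  simp only [l1, h]
  rw [← Finset.sum_image (f := fun l => |c l|) (g := List.ofFn) fun x _ y _ hxy =>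
    List.ofFn_injective hxy]
  refine Finset.sum_le_sum_of_subset_of_nonneg ?_ fun _ _ _ => abs_nonneg _
  intro l hl
  obtain ⟨t, ht, rfl⟩ := Finset.mem_image.1 hl
  rw [Finsupp.mem_support_iff] at ht ⊢
  exact ht

end Oriented

/-! ### Fillings in the Rips complex, and the theorem. -/

section RipsFilling

variable {V : Type u} {G : SimpleGraph V} {δ κ : ℕ}

lemma edist_le_iff_dist_le (hG : G.Connected) {x y : V} {r : ℕ} :
    G.edist x y ≤ r ↔ G.dist x y ≤ r := by
  rw [← (hG x y).coe_dist_eq_edist]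
  exact_mod_cast Iff.rfl

lemma le_skeletonGraph_ripsComplex (hκ : 1 ≤ κ) : G ≤ skeletonGraph (ripsComplex G κ) := by
  intro x y hxy
  have h1 : G.edist x y ≤ κ := by
    rw [SimpleGraph.edist_eq_one_iff_adj.2 hxy]
    exact_mod_cast hκ
  refine ⟨hxy.ne, Or.inl ⟨{x, y}, ⟨⟨x, by simp⟩, ?_⟩, by simp, by simp⟩⟩
  intro a ha b hb
  rw [Finset.mem_insert, Finset.mem_singleton] at ha hb
  rcases ha with rfl | rfl <;> rcases hb with rfl | rfl
  · simp
  · exact h1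
  · rwa [SimpleGraph.edist_comm]
  · simp

lemma dist_le_of_skeletonGraph_edist_le (hG : G.Connected) {x y : V} {r : ℕ}
    (h : (skeletonGraph (ripsComplex G κ)).edist x y ≤ r) : G.dist x y ≤ κ * r := by
  have hr : (skeletonGraph (ripsComplex G κ)).Reachable x y :=
    SimpleGraph.reachable_of_edist_ne_top (ne_top_of_le_ne_top (ENat.natCast_ne_top r) h)
  obtain ⟨p, hp⟩ := hr.exists_walk_length_eq_edist
  rw [← hp] at h
  have h' : p.length ≤ r := by exact_mod_cast h
  refine le_trans ?_ (Nat.mul_le_mul_left κ h')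
  clear h h' hp hr
  induction p with
  | nil => simp
  | cons hadj p ih =>
    rename_i a b c
    have h1 : G.dist a b ≤ κ := by
      rw [← edist_le_iff_dist_le hG]
      rcases hadj.2 with ⟨s, hs, ha, hb⟩ | ⟨s, hs, hb, ha⟩ <;> exact hs.2 _ ha _ hb
    have h2 := hG.dist_triangle (u := a) (v := b) (w := c)
    rw [SimpleGraph.Walk.length_cons, mul_add, mul_one]
    omega

lemma skeletonGraph_edist_le (hG : G.Connected) (hκ : 1 ≤ κ) {x y : V} {r : ℕ}
    (h : G.dist x y ≤ r) : (skeletonGraph (ripsComplex G κ)).edist x y ≤ r :=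
  (SimpleGraph.edist_anti (le_skeletonGraph_ripsComplex hκ)).trans
    ((edist_le_iff_dist_le hG).2 h)

lemma range_eq_coe_of_forall_dist_le (hG : G.Connected) {n : ℕ} (t : Fin (n + 1) → V)
    (h : ∀ i j, G.dist (t i) (t j) ≤ κ) :
    ∃ s ∈ (ripsComplex G κ).faces, (s : Set V) = Set.range t := by
  refine ⟨Finset.univ.image t, ⟨⟨t 0, by simp⟩, ?_⟩, by simp⟩
  intro x hx y hy
  obtain ⟨i, -, rfl⟩ := Finset.mem_image.1 hx
  obtain ⟨j, -, rfl⟩ := Finset.mem_image.1 hy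
  exact (edist_le_iff_dist_le hG).2 (h i j)

/-- The oriented chain defined by an ordered chain. -/
def orient (n : ℕ) (c : WordChain V) : (Fin n → V) →₀ ℝ := alternation n (wordsToTuples n c)

lemma exists_of_orient_apply_ne_zero {n : ℕ} {B : Set V} {c : WordChain V}
    (hc : c ∈ supported ℝ ℝ (smallWords G κ n B)) {t : Fin n → V} (ht : orient n c t ≠ 0) :
    (∀ i j, G.dist (t i) (t j) ≤ κ) ∧ ∀ i, t i ∈ B := by
  rw [orient, alternation_apply] at ht
  obtain ⟨σ, -, hσ⟩ := Finset.exists_ne_zero_of_sum_ne_zero ht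
  have h1 : c (List.ofFn (t ∘ σ.symm)) ≠ 0 := right_ne_zero_of_mul hσ
  obtain ⟨-, h2, h3⟩ := hc (Finsupp.mem_support_iff.2 h1)
  have h4 : ∀ i, t i ∈ List.ofFn (t ∘ σ.symm) := fun i =>
    (List.mem_ofFn' _ _).2 ⟨σ i, by simp⟩
  exact ⟨fun i j => h2 _ (h4 i) _ (h4 j), fun i => h3 _ (h4 i)⟩

lemma orient_mem_chains (hG : G.Connected) {n : ℕ} {B : Set V} {c : WordChain V}
    (hc : c ∈ supported ℝ ℝ (smallWords G κ (n + 1) B)) :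
    orient (n + 1) c ∈ chains (ripsComplex G κ) n :=
  ⟨isAlternating_alternation _, fun t ht =>
    range_eq_coe_of_forall_dist_le hG t (exists_of_orient_apply_ne_zero hc ht).1⟩

lemma supp_orient_subset (hG : G.Connected) {n : ℕ} {B : Set V} {c : WordChain V}
    (hc : c ∈ supported ℝ ℝ (smallWords G κ (n + 1) B)) :
    supp (orient (n + 1) c) ⊆ (fullSubcomplex (ripsComplex G κ) B).faces := by
  rintro s ⟨t, ht, hs⟩
  obtain ⟨h1, h2⟩ := exists_of_orient_apply_ne_zero hc ht
  obtain ⟨s', hs', hs''⟩ := range_eq_coe_of_forall_dist_le hG t h1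
  obtain rfl : s = s' := by
    rw [← Finset.coe_inj, hs, hs'']
  refine ⟨hs', ?_⟩
  rw [hs]
  rintro _ ⟨i, rfl⟩
  exact h2 i

/-- The number of permutations in the alternation cancels the factorial in `l1norm`. -/
lemma l1norm_orient_le {n : ℕ} (c : WordChain V) : l1norm (orient (n + 1) c) ≤ l1 c := by
  have h : l1 (orient (n + 1) c) ≤ (n + 1).factorial * l1 c :=
    (l1_alternation_le _).trans (by gcongr; exact l1_wordsToTuples_le c)
  change l1 (orient (n + 1) c) / _ ≤ _
  rw [div_le_iff₀ (by positivity), mul_comm]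
  exact h

/-- Uniform filling of cycles near `n` geodesics in the Rips complex of a hyperbolic graph. -/
theorem exists_rips_filling (hG : G.Connected) (hδ : IsHyperbolic G δ) (hκ : 4 * δ + 6 ≤ κ)
    (n k L : ℕ) (hk : 2 ≤ k) : ∃ (L' N : ℕ), ∀ z ∈ cycles (ripsComplex G κ) k,
      ∀ α : Fin n → GeodesicSegment G,
        supp z ⊆ (nbhd (ripsComplex G κ) L (⋃ j, (α j).points)).faces →
        ∃ a ∈ chains (ripsComplex G κ) (k + 1), boundary (k + 1) a = z ∧
          supp a ⊆ (nbhd (ripsComplex G κ) L' (⋃ j, (α j).points)).faces ∧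
          l1norm a ≤ N * l1norm z ∧
          ∀ H, GeodesicallyConvex G H →
            supp z ⊆ (fullSubcomplex (ripsComplex G κ) H).faces →
            supp a ⊆ (fullSubcomplex (ripsComplex G κ) H).faces := by
  obtain ⟨r, N, hfill⟩ := exists_word_filling hG (hδ.thinTriangles hG) hκ n (k + 1) (κ * L)
    (by omega)
  -- Edges of the 1-skeleton have length at most `κ` in `G`, whence `κ * L` above. Conversely, edges
  -- of `G` lie in the 1-skeleton, so the displacement `r` is added unchanged.
  refine ⟨r + L, N, ?_⟩
  rintro z ⟨⟨hz, hzface⟩, hz0⟩ α hzα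
  replace hz : IsAlternating z := hz
  replace hz0 : boundary k z = 0 := hz0
  set W : Set V := {x | ∃ t, z t ≠ 0 ∧ x ∈ Set.range t} with hW
  have hWsub : ∀ H : Set V, supp z ⊆ (fullSubcomplex (ripsComplex G κ) H).faces → W ⊆ H := by
    rintro H hH x ⟨t, ht, hx⟩
    obtain ⟨s, -, hs⟩ := hzface t ht
    rw [← hs] at hx
    exact (hH ⟨t, ht, hs⟩).2 hx
  have hnear := hWsub _ hzα
  have hclose : ∀ t, z t ≠ 0 → ∀ i j, G.dist (t i) (t j) ≤ κ := by
    intro t ht i j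
    obtain ⟨s, hs, hst⟩ := hzface t ht
    have hmem : ∀ i, t i ∈ s := fun i => by
      rw [← Finset.mem_coe, hst]
      exact ⟨i, rfl⟩
    exact (edist_le_iff_dist_le hG).1 (hs.2 _ (hmem i) _ (hmem j))
  set ρ : ℝ := ((k + 1).factorial : ℝ)⁻¹ with hρ
  have hρ0 : ((k + 1).factorial : ℝ) * ρ = 1 := mul_inv_cancel₀ (by positivity)
  -- Alternation multiplies an alternating chain by `(k + 1)!`. With the factor `ρ`, orienting `c`
  -- gives back `z`, and the `ℓ¹`-norms match.
  set c : WordChain V := tuplesToWords (k + 1) (ρ • z) with hc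
  have hcl1 : l1 c ≤ l1norm z := by
    refine (l1_lmapDomain_le _ _).trans ?_
    rw [l1_smul, abs_of_nonneg (by positivity), hρ, inv_mul_eq_div]
    exact le_rfl
  have hcsupp : c ∈ supported ℝ ℝ (smallWords G κ (k + 1) W) := by
    rw [hc, map_smul]
    refine Submodule.smul_mem _ _ ?_
    refine lmapDomain_mem_supported (s := {t | z t ≠ 0}) ?_ fun t ht => Finsupp.mem_support_iff.1 ht
    intro t ht
    refine ⟨by simp, ?_, ?_⟩
    · intro x hx y hy
      obtain ⟨i, rfl⟩ := (List.mem_ofFn' _ _).1 hx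
      obtain ⟨j, rfl⟩ := (List.mem_ofFn' _ _).1 hy
      exact hclose t ht i j
    · intro x hx
      exact ⟨t, ht, (List.mem_ofFn' _ _).1 hx⟩
  have hc0 : wordBoundary c = 0 := by
    rw [hc, wordBoundary_tuplesToWords, map_smul, tupleBoundary_of_alternating hz hz0, smul_zero,
      map_zero]
  -- Here `k ≥ 2` enters: each tuple in the support has three entries, two of which acquire the same
  -- image, and an alternating chain vanishes on tuples with repetitions.
  have hcol : ∀ f : V → V, (∀ x ∈ W, ∀ y ∈ W, ∀ z ∈ W, G.dist x y ≤ κ → G.dist y z ≤ κ →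
      G.dist x z ≤ κ → f x = f y ∨ f y = f z ∨ f x = f z) → wordMap f c = 0 := by
    intro f hf
    have h1 : lmapDomain ℝ ℝ (fun t : Fin (k + 1) → V => f ∘ t) z = 0 := by
      ext t
      by_contra ht
      obtain ⟨t₀, ht₀, rfl⟩ := Finset.mem_image.1
        (Finsupp.mapDomain_support (Finsupp.mem_support_iff.2 ht))
      rw [Finsupp.mem_support_iff] at ht₀
      have hmem : ∀ i, t₀ i ∈ W := fun i => ⟨t₀, ht₀, i, rfl⟩
      have halt := isAlternating_lmapDomain hz f
      have hne : ∀ i j : Fin (k + 1), i ≠ j → f (t₀ i) ≠ f (t₀ j) := fun i j hij h =>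
        ht (halt.apply_eq_zero hij h)
      have hcl := hclose t₀ ht₀
      rcases hf _ (hmem ⟨0, by omega⟩) _ (hmem ⟨1, by omega⟩) _ (hmem ⟨2, by omega⟩) (hcl _ _)
        (hcl _ _) (hcl _ _) with h | h | h
      · exact hne _ _ (by simp) h
      · exact hne _ _ (by simp) h
      · exact hne _ _ (by simp) h
    have h2 : wordMap f (tuplesToWords (k + 1) z) =
        tuplesToWords (k + 1) (lmapDomain ℝ ℝ (fun t : Fin (k + 1) → V => f ∘ t) z) := by
      simp only [wordMap, tuplesToWords, lmapDomain_apply, ← Finsupp.mapDomain_comp]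
      congr 1
      ext t : 1
      exact List.map_ofFn
    rw [hc, map_smul, map_smul, h2, h1, map_zero, smul_zero]
  obtain ⟨a, ha, hal1, har, haH⟩ := hfill (fun j => (α j).start) (fun j => (α j).finish) W c
    (fun x hx => by
      obtain ⟨b, hb, hxb⟩ := hnear hx
      obtain ⟨j, hj⟩ := Set.mem_iUnion.1 hb
      refine ⟨j, b, between_of_mem_support hG ?_ hj, dist_le_of_skeletonGraph_edist_le hG hxb⟩
      have := (α j).length_eq
      rw [← (hG _ _).coe_dist_eq_edist] at this
      exact_mod_cast this) hcsupp hc0 hcol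
  refine ⟨orient (k + 2) a, orient_mem_chains hG har, ?_, ?_, ?_, ?_⟩
  · have h1 : tupleBoundary (k + 1) (wordsToTuples (k + 2) a) = ρ • z := by
      rw [← wordsToTuples_tuplesToWords (tupleBoundary (k + 1) (wordsToTuples (k + 2) a)),
        ← wordBoundary_tuplesToWords, tuplesToWords_wordsToTuples, ha, hc,
        wordsToTuples_tuplesToWords]
      exact supported_mono (fun l hl => hl.1) har
    rw [orient, boundary_alternation, h1, map_smul, alternation_of_alternating hz, smul_smul,
      mul_comm, hρ0, one_smul]
  · refine (supp_orient_subset hG har).trans ?_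
    rintro s ⟨hs, hs'⟩
    refine ⟨hs, fun x hx => ?_⟩
    obtain ⟨y, hy, hxy⟩ := hs' hx
    obtain ⟨b, hb, hyb⟩ := hnear hy
    refine ⟨b, hb, (SimpleGraph.edist_triangle (v := y)).trans ?_⟩
    rw [Nat.cast_add]
    exact add_le_add (skeletonGraph_edist_le hG (by omega) hxy) hyb
  · refine (l1norm_orient_le a).trans (hal1.trans ?_)
    gcongr
  · intro H hH hzH
    exact supp_orient_subset hG (haH H hH (hWsub H hzH))

end RipsFilling

end

end CuspedRips

theorem mainTheorem4 {Γ I : Type*} [Group Γ] [Finite I] [Nonempty I]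
    (P : I → Subgroup Γ) (S : Set Γ) (hS : CuspedRips.IsCompatible P S)
    (δ κ C : ℕ) (hδ : CuspedRips.IsHyperbolic (CuspedRips.cuspedGraph P S) δ)
    (hκ : 4 * δ + 6 ≤ κ) (hC : δ < C)
    (n k L : ℕ) (hk : 2 ≤ k) :
    ∃ (L' : ℕ) (M : ℕ → ℕ),
      ∀ z ∈ CuspedRips.cycles (CuspedRips.ripsComplex (CuspedRips.cuspedGraph P S) κ) k,
      ∀ α : Fin n → CuspedRips.GeodesicSegment (CuspedRips.cuspedGraph P S),
        CuspedRips.supp z ⊆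
          (CuspedRips.nbhd (CuspedRips.ripsComplex (CuspedRips.cuspedGraph P S) κ) L
            (⋃ j, (α j).points)).faces →
        ∃ a ∈ CuspedRips.chains (CuspedRips.ripsComplex (CuspedRips.cuspedGraph P S) κ) (k + 1),
          CuspedRips.boundary (k + 1) a = z ∧
          CuspedRips.supp a ⊆
            (CuspedRips.nbhd (CuspedRips.ripsComplex (CuspedRips.cuspedGraph P S) κ) L'
              (⋃ j, (α j).points)).faces ∧
          CuspedRips.l1norm a ≤ (M (CuspedRips.maxh z) : ℝ) * CuspedRips.l1norm z ∧
          ∀ (g : Γ) (i : I),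
            CuspedRips.supp z ⊆
              (CuspedRips.fullSubcomplex (CuspedRips.ripsComplex (CuspedRips.cuspedGraph P S) κ)
                (CuspedRips.horoballVertices P C g i)).faces →
            CuspedRips.supp a ⊆
              (CuspedRips.fullSubcomplex (CuspedRips.ripsComplex (CuspedRips.cuspedGraph P S) κ)
                (CuspedRips.horoballVertices P C g i)).faces := by
  have hX := CuspedRips.cuspedGraph_connected (P := P) hS.closure_eq
  obtain ⟨L', N, h⟩ := CuspedRips.exists_rips_filling hX hδ hκ n k L hk
  refine ⟨L', fun _ => N, fun z hz α hzα => ?_⟩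
  obtain ⟨a, ha, hab, hsupp, hnorm, hH⟩ := h z hz α hzα
  exact ⟨a, ha, hab, hsupp, hnorm, fun g i => hH _
    (CuspedRips.geodesicallyConvex_horoballVertices hX hS.closure_inter_eq
      (hδ.thinTriangles hX) hC g i)⟩
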